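/- Let $p\equiv 3\pmod 4$ be a prime, $n$ an odd positive integer, $q=p^n$, and let $V=\mathbb F_q^3$ (column vectors), an elementary abelian group of order $q^3$. Let $\mathrm{Aut}(V)$ be the group of all automorphisms of the additive group of $V$, and let $A=ES\le \mathrm{Aut}(V)$, where $$E=\left\{\begin{pmatrix}1&x&x^2/2\\0&1&x\\0&0&1\end{pmatrix}\ :\ x\in\mathbb F_q\right\},\qquad S=\{sI_3 : s\in\mathbb F_q^*\text{ a square}\}.$$ A skew Hadamard difference set in $V$ is a difference set $D\subset V$ such that $V\setminus\{0\}$ is the disjoint union of $D$ and $-D$. Let $\mathbb D$ be the set of all $A$-invariant skew Hadamard difference sets in $V$, and for $D\in\mathbb D$ let $\mathrm{des}(D)=\{D+h : h\in V\}$ be the translation design with point set $V$ generated by $D$. Two such designs are isomorphic if some permutation of $V$ maps the block set of the first onto that of the second. Then: 1. $|N_{\mathrm{Aut}(V)}(A)|=n(q-1)^2q^2$ and $[N_{\mathrm{Aut}(V)}(A):A]=2n(q-1)q$. 2. For each $D\in\mathbb D$, $\mathrm{des}(D)$ is a symmetric $2$-$\left(q^3,\frac{q^3-1}{2},\frac{q^3-3}{4}\right)$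 design. Moreover $|\mathbb D|=4\binom{q}{(q+1)/2}$, and there are exactly $4\binom{q}{(q+1)/2}$ distinct designs $\mathrm{des}(D)$, $D\in\mathbb D$. 3. The number of isomorphism classes of the designs $\mathrm{des}(D)$, $D\in\mathbb D$, is at least $$\frac{4\binom{q}{(q+1)/2}}{2n(q-1)q}\;>\;\frac{2^{q+2}/q}{2nq(q-1)}\;>\;\frac{2^{q+1}}{q^4}.$$ In particular, it grows exponentially in $q$. -/

import Mathlib

open scoped Pointwise

/-! ### Difference sets and designs -/

section Designs

/-- `D` is a `(v, k, l)`-difference set of the (additive) finite group `H`: `|H| = v`, `|D| = k`, and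
every non-zero `h` is a difference of elements of `D` in exactly `l` ways. -/
def IsDifferenceSet {H : Type*} [AddCommGroup H] (D : Set H) (v k l : ℕ) : Prop :=
  Nat.card H = v ∧ D.ncard = k ∧
    ∀ h : H, h ≠ 0 → {x : H × H | x.1 ∈ D ∧ x.2 ∈ D ∧ x.1 - x.2 = h}.ncard = l

/-- A skew Hadamard difference set: a difference set `D` such that `H \ {0}` is the disjoint union
of `D` and `-D`. -/
def IsSkewHadamard {H : Type*} [AddCommGroup H] (D : Set H) : Prop :=
  (∃ v k l : ℕ, IsDifferenceSet D v k l) ∧ D ∪ -D = {0}ᶜ ∧ Disjoint D (-D)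

/-- The block set of the translation design generated by `D`: all translates `D + h`. -/
def translationDesign {H : Type*} [AddCommGroup H] (D : Set H) : Set (Set H) :=
  {B | ∃ h : H, B = (fun d => d + h) '' D}

/-- `𝓑` is the block set of a symmetric `2-(v, k, l)` design on the point set `X`. -/
structure IsSymmetricDesign {X : Type*} (𝓑 : Set (Set X)) (v k l : ℕ) : Prop where
  card_points : Nat.card X = v
  card_blocks : 𝓑.ncard = v
  card_block : ∀ B ∈ 𝓑, B.ncard = k
  card_pair : ∀ x y : X, x ≠ y → {B ∈ 𝓑 | x ∈ B ∧ y ∈ B}.ncard = l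

/-- Isomorphism of designs on the point set `X` (given by their block sets): some permutation of
the points maps the blocks of the first exactly onto the blocks of the second. -/
def DesignIso {X : Type*} (𝓑 𝓑' : Set (Set X)) : Prop :=
  ∃ g : Equiv.Perm X, (fun B : Set X => g '' B) '' 𝓑 = 𝓑'

theorem designIso_equivalence (X : Type*) : Equivalence (DesignIso (X := X)) where
  refl 𝓑 := ⟨1, by simp⟩
  symm := by
    rintro 𝓑 _ ⟨g, rfl⟩
    refine ⟨g⁻¹, ?_⟩
    rw [Set.image_image]
    simp [Set.image_image]
  trans := by
    rintro 𝓑 _ _ ⟨g, rfl⟩ ⟨h, rfl⟩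
    refine ⟨h * g, ?_⟩
    rw [Set.image_image]
    simp [Set.image_image]

/-- The isomorphism relation on designs with point set `X`. -/
def designSetoid (X : Type*) : Setoid (Set (Set X)) :=
  ⟨DesignIso, designIso_equivalence X⟩

/-- The number of isomorphism classes represented in a set of designs on `X`. -/
noncomputable def numIsoClasses {X : Type*} (𝒞 : Set (Set (Set X))) : ℕ :=
  (Quotient.mk (designSetoid X) '' 𝒞).ncard

end Designs

/-! ### The group `A` and the `A`-invariant skew Hadamard difference sets -/

section GroupA

variable (F : Type*) [Field F]

variable {F} in
/-- The unipotent matrix `E(x)`. -/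
def matE (x : F) : Matrix (Fin 3) (Fin 3) F :=
  !![1, x, x ^ 2 / 2; 0, 1, x; 0, 0, 1]

/-- `Aut(V)`: all automorphisms of the additive group of `V = F³` (the `ℤ`-linear ones; they need not
be `F`-linear). -/
abbrev AutV : Type _ := (Fin 3 → F) ≃ₗ[ℤ] (Fin 3 → F)

/-- The group `E = {E(x) | x ∈ F}`, acting on column vectors. In characteristic different from two
the generating set is already a subgroup; the same holds for `groupS`. -/
def groupE : Subgroup (AutV F) :=
  Subgroup.closure {g | ∃ x : F, ∀ v, g v = (matE x).mulVec v}

/-- The group `S` of scalar maps `s I₃`, with `s` a non-zero square. -/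
def groupS : Subgroup (AutV F) :=
  Subgroup.closure {g | ∃ s : F, s ≠ 0 ∧ IsSquare s ∧ ∀ v, g v = s • v}

/-- `A = E S`, as a subgroup of `Aut(V)`. -/
def groupA : Subgroup (AutV F) := groupE F ⊔ groupS F

/-- The set of all `A`-invariant skew Hadamard difference sets of `V = F³`. -/
def invariantSHDS : Set (Set (Fin 3 → F)) :=
  {D | IsSkewHadamard D ∧ ∀ g ∈ groupA F, g '' D = D}

/-- The translation designs generated by the `A`-invariant skew Hadamard difference sets. -/
def invariantDesigns : Set (Set (Set (Fin 3 → F))) :=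
  translationDesign '' invariantSHDS F

end GroupA

/-! ### Skew Hadamard difference sets in finite abelian groups -/

section DifferenceSets

variable {H : Type*} [AddCommGroup H]

/-! Write χ for the quadratic character of F and q for its order; χ(-1) = -1 because q ≡ 3 mod 4. A
skew set is encoded by its odd sign function f, which is ±1 away from zero. The non-zero orbits of
the group generated by A and -1 are represented by (1,0,0), (0,1,0) and (-t/2,0,1), where t = (b² -
2ac)/c² is the invariant of (a,b,c) with c ≠ 0. So A-invariant skew sets correspond to free choices
of two signs α, β and a function ε : F → {±1} (`exists_eq_invSet`, `invSet_injective`).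

A skew set is a difference set iff all non-trivial autocorrelations of f are -1, hence iff all
non-trivial Fourier coefficients have square -q³. Here each coefficient is the quadratic Gauss sum,
whose square is -q, times an integer (`hat_invSign`). These integers, computed by completing the
square, all have square q² exactly if ∑ ε = χ(2)α (`hatCoeff_sq_iff`). The sign β is free, which
gives the count.

The normalizer of A consists of the maps `nrm τ k s m l`, with unique parameters. To bound the
isomorphism classes, let P = VE, a p-group contained in the automorphism group of every des(D). If g
maps des(D) to des(D'), then gPg⁻¹ also lies in Aut(des(D')). In a p-subgroup of Aut(des(D')) that
contains and normalizes P, no other conjugate of P occurs (`conj_affine_groupE_eq`): non-trivial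
linear parts have few fixed points, and field automorphisms contribute only a factor n with n² < q.
By Sylow's theorem and the growth of normalizers in nilpotent groups (`exists_mul_mem_normalizer`),
g may be changed by an automorphism of des(D') so that it normalizes P.

Such a permutation is affine, and its linear part is semilinear up to one additive map L. If L were
not semilinear, ε would have a non-zero period, which is impossible because ∑ ε = ±1 is prime to p
(`eq_zero_of_period`). So D and D' are in one orbit of the normalizer of A; as A fixes D, an
isomorphism class accounts for at most [N(A) : A] difference sets. -/

lemma ncard_differences (D : Set H) (h : H) :
    {x : H × H | x.1 ∈ D ∧ x.2 ∈ D ∧ x.1 - x.2 = h}.ncard = {x : H | x ∈ D ∧ x + h ∈ D}.ncard := by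
  have hinj : Function.Injective (fun x : H => (x + h, x)) := fun x y hxy => (Prod.ext_iff.1 hxy).2
  rw [← Set.ncard_image_of_injective _ hinj]
  congr 1
  ext ⟨x, y⟩
  simp only [Set.mem_ofPred_eq, Set.mem_image, Prod.mk.injEq]
  constructor
  · rintro ⟨hx, hy, rfl⟩
    exact ⟨y, ⟨hy, by simpa using hx⟩, by simp, rfl⟩
  · rintro ⟨z, ⟨hz, hz'⟩, rfl, rfl⟩
    exact ⟨hz', hz, by simp⟩

open Classical in
/-- The sign function of a set `D`: the indicator of `D` minus the indicator of `-D`. -/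
noncomputable def setSign (D : Set H) (v : H) : ℤ :=
  (if v ∈ D then 1 else 0) - (if -v ∈ D then 1 else 0)

lemma setSign_neg (D : Set H) (v : H) : setSign D (-v) = -setSign D v := by
  unfold setSign
  rw [neg_neg]
  ring

/-- `D` and `-D` partition the non-zero elements. -/
def IsSkew (D : Set H) : Prop := D ∪ -D = {0}ᶜ ∧ Disjoint D (-D)

namespace IsSkew

variable {D : Set H}

lemma zero_notMem (hD : IsSkew D) : (0 : H) ∉ D := fun h => by
  have : (0 : H) ∈ D ∪ -D := Or.inl h
  rw [hD.1] at this
  exact this rfl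

lemma neg_mem_iff (hD : IsSkew D) {v : H} (hv : v ≠ 0) : -v ∈ D ↔ v ∉ D := by
  constructor
  · intro h h'
    exact Set.disjoint_left.1 hD.2 h' (by simpa using h)
  · intro h
    have : v ∈ D ∪ -D := by rw [hD.1]; exact hv
    rcases this with h' | h'
    · exact absurd h' h
    · simpa using h'

open Classical in
lemma setSign_eq (hD : IsSkew D) (v : H) :
    setSign D v = 2 * (if v ∈ D then 1 else 0) - 1 + (if v = 0 then 1 else 0) := by
  by_cases hv : v = 0
  · subst hv
    simp [setSign, hD.zero_notMem]
  · have := hD.neg_mem_iff hv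
    by_cases h : v ∈ D <;> simp [setSign, h, this, hv]

lemma mem_iff_setSign (hD : IsSkew D) (v : H) : v ∈ D ↔ setSign D v = 1 := by
  classical
  rw [hD.setSign_eq]
  by_cases hv : v = 0
  · subst hv
    simp [hD.zero_notMem]
  · by_cases h : v ∈ D <;> simp [h, hv]

lemma setSign_sq (hD : IsSkew D) {v : H} (hv : v ≠ 0) : setSign D v * setSign D v = 1 := by
  classical
  rw [hD.setSign_eq]
  by_cases h : v ∈ D <;> simp [h, hv]

lemma setSign_zero (D : Set H) : setSign D 0 = 0 := by
  unfold setSign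
  rw [neg_zero, sub_self]

lemma sum_setSign_mul_self (hD : IsSkew D) [Fintype H] :
    ∑ x, setSign D x * setSign D x = Nat.card H - 1 := by
  classical
  have : ∀ x, setSign D x * setSign D x = 1 - (if x = 0 then 1 else 0) := by
    intro x
    by_cases h : x = 0
    · simp [h, setSign_zero]
    · simp [hD.setSign_sq h, h]
  simp [this, Finset.sum_sub_distrib]

variable [Finite H]

lemma two_mul_ncard (hD : IsSkew D) : 2 * D.ncard + 1 = Nat.card H := by
  have h1 : (-D).ncard = D.ncard := by
    rw [← Set.image_neg_eq_neg]
    exact Set.ncard_image_of_injective _ neg_injective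
  have h2 := Set.ncard_union_eq hD.2 (Set.toFinite _) (Set.toFinite _)
  rw [hD.1, h1] at h2
  have h3 := Set.ncard_add_ncard_compl ({0} : Set H)
  rw [Set.ncard_singleton] at h3
  omega

/-- Expand the sign function as 2·1_D - 1 + 1_{0}. The corrections at x = 0 and x = -h cancel
because exactly one of h, -h lies in D, and 2|D| + 1 = |H| eliminates |D|. -/
lemma sum_setSign_mul (hD : IsSkew D) [Fintype H] {h : H} (hh : h ≠ 0) :
    ∑ x, setSign D x * setSign D (x + h) =
      4 * ({x : H | x ∈ D ∧ x + h ∈ D}.ncard : ℤ) - Nat.card H + 2 := by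
  classical
  set d : H → ℤ := fun x => if x ∈ D then 1 else 0 with hd
  have hk : ∑ x, d x = D.ncard := by
    simp [hd, Finset.sum_boole, Set.ncard_eq_toFinset_card']
  have hN : ∑ x, d x * d (x + h) = ({x : H | x ∈ D ∧ x + h ∈ D}.ncard : ℤ) := by
    simp only [hd, ← ite_and, mul_ite, mul_one, mul_zero]
    rw [Set.ncard_eq_toFinset_card', Finset.sum_boole]
    congr 2
    ext x
    simp [and_comm]
  have hk' : ∑ x, d (x + h) = D.ncard := by
    rw [← hk]; exact Fintype.sum_equiv (Equiv.addRight h) _ _ (fun _ => rfl)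
  have hdd : d h + d (-h) = 1 := by
    have := hD.neg_mem_iff hh
    by_cases h' : h ∈ D <;> simp [hd, this, h']
  have hcard := hD.two_mul_ncard
  have key : ∀ x, setSign D x * setSign D (x + h) =
      4 * (d x * d (x + h)) - 2 * d x - 2 * d (x + h) + 1 +
      (if x = 0 then 2 * d h - 1 else 0) + (if x = -h then 2 * d (-h) - 1 else 0) := by
    intro x
    rw [hD.setSign_eq, hD.setSign_eq]
    have e : x + h = 0 ↔ x = -h := add_eq_zero_iff_eq_neg
    by_cases h1 : x = 0
    · subst h1
      have : (0 : H) ≠ -h := fun h' => hh (by simpa using h'.symm)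
      by_cases h3 : h ∈ D <;> simp [this, hd, hh, h3, hD.zero_notMem]
    · by_cases h2 : x = -h
      · subst h2
        by_cases h3 : -h ∈ D <;> simp [hd, hh, h3, hD.zero_notMem]
      · by_cases h3 : x ∈ D <;> by_cases h4 : x + h ∈ D <;> simp [e, h1, h2, hd, h3, h4]
  simp_rw [key]
  simp only [Finset.sum_add_distrib, Finset.sum_sub_distrib, ← Finset.mul_sum, hk, hk', hN,
    Finset.sum_ite_eq', Finset.mem_univ, if_true, Finset.sum_const, Finset.card_univ]
  rw [← Nat.card_eq_fintype_card, ← hcard]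
  push_cast
  simp
  linarith

/-- The size of the intersection of a difference set with its non-trivial translates is determined
by the skewness. -/
lemma ncard_inter_of_isDifferenceSet (hD : IsSkew D) {v k l : ℕ} (h : IsDifferenceSet D v k l)
    {x : H} (hx : x ≠ 0) : 4 * l + 3 = Nat.card H := by
  classical
  have := Fintype.ofFinite H
  obtain ⟨-, -, hl⟩ := h
  simp_rw [ncard_differences] at hl
  have h0 : ∑ y, setSign D y = 0 := by
    have : ∑ y, setSign D y = ∑ y, setSign D (-y) :=
      Fintype.sum_equiv (Equiv.neg H) _ _ (fun y => by simp)
    simp_rw [setSign_neg, Finset.sum_neg_distrib] at this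
    linarith
  -- All autocorrelations add up to (∑ f)² = 0. The one at 0 is |H| - 1 and the others agree, so
  -- their common value is -1.
  have h1 : ∑ h, ∑ y, setSign D y * setSign D (y + h) = 0 := by
    rw [Finset.sum_comm]
    apply Finset.sum_eq_zero
    intro y _
    rw [← Finset.mul_sum]
    have : ∑ h, setSign D (y + h) = ∑ h, setSign D h :=
      Fintype.sum_equiv (Equiv.addLeft y) _ _ (fun _ => rfl)
    rw [this, h0, mul_zero]
  rw [← Finset.add_sum_erase _ _ (Finset.mem_univ (0 : H))] at h1
  have h2 : ∀ h ∈ Finset.univ.erase (0 : H), ∑ y, setSign D y * setSign D (y + h) =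
      4 * (l : ℤ) - Nat.card H + 2 := by
    intro h hh
    rw [hD.sum_setSign_mul (Finset.ne_of_mem_erase hh), hl h (Finset.ne_of_mem_erase hh)]
  rw [Finset.sum_congr rfl h2] at h1
  simp only [add_zero, hD.sum_setSign_mul_self, Finset.sum_const, nsmul_eq_mul] at h1
  rw [Finset.card_erase_of_mem (Finset.mem_univ _), Finset.card_univ, ← Nat.card_eq_fintype_card,
    Nat.cast_sub Nat.card_pos] at h1
  have h3 : (1 : ℤ) < Nat.card H := by
    have : Nontrivial H := ⟨x, 0, hx⟩
    exact_mod_cast Finite.one_lt_card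
  have h4 : ((Nat.card H : ℤ) - 1) * (4 * (l : ℤ) - Nat.card H + 3) = 0 := by
    push_cast at h1
    linarith
  rcases mul_eq_zero.1 h4 with h5 | h5 <;> omega

/-- A skew set is a difference set if and only if its sign function is perfectly autocorrelated. -/
lemma isDifferenceSet_iff (hD : IsSkew D) [Fintype H] (hc : Nat.card H % 4 = 3) :
    (∃ v k l, IsDifferenceSet D v k l) ↔
      ∀ h : H, h ≠ 0 → ∑ x, setSign D x * setSign D (x + h) = -1 := by
  constructor
  · rintro ⟨v, k, l, h⟩ x hx
    have h1 := hD.ncard_inter_of_isDifferenceSet h hx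
    rw [hD.sum_setSign_mul hx, ← ncard_differences, h.2.2 x hx, ← h1]
    push_cast
    ring
  · intro h
    refine ⟨Nat.card H, D.ncard, (Nat.card H - 3) / 4, rfl, rfl, fun x hx => ?_⟩
    have h1 := h x hx
    rw [hD.sum_setSign_mul hx] at h1
    rw [ncard_differences]
    omega

end IsSkew

namespace IsSkewHadamard

variable {D : Set H}

lemma isSkew (hD : IsSkewHadamard D) : IsSkew D := hD.2

lemma image_equiv (hD : IsSkewHadamard D) (φ : H ≃+ H) : IsSkewHadamard (φ '' D) := by
  have hneg : -(φ '' D) = φ '' (-D) := by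
    ext x
    simp only [Set.mem_neg, Set.mem_image]
    constructor
    · rintro ⟨y, hy, hxy⟩
      exact ⟨-y, by simpa using hy, by rw [map_neg, hxy, neg_neg]⟩
    · rintro ⟨y, hy, rfl⟩
      exact ⟨-y, hy, map_neg _ _⟩
  refine ⟨?_, ?_, ?_⟩
  · obtain ⟨v, k, l, hv, hk, hl⟩ := hD.1
    refine ⟨v, k, l, hv, by rw [Set.ncard_image_of_injective _ φ.injective, hk], fun h hh => ?_⟩
    rw [← hl (φ.symm h) (by simpa using hh), ncard_differences, ncard_differences,
      ← Set.ncard_image_of_injective {x | x ∈ D ∧ x + φ.symm h ∈ D} φ.injective]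
    congr 1
    ext x
    simp only [Set.mem_ofPred_eq, Set.mem_image]
    constructor
    · rintro ⟨⟨y, hy, rfl⟩, z, hz, hzy⟩
      refine ⟨y, ⟨hy, ?_⟩, rfl⟩
      have : z = y + φ.symm h := φ.injective (by simp [hzy])
      rwa [← this]
    · rintro ⟨y, ⟨hy, hy'⟩, rfl⟩
      exact ⟨⟨y, hy, rfl⟩, _, hy', by simp⟩
  · rw [hneg, ← Set.image_union, hD.2.1, Set.image_compl_eq φ.bijective]
    simp
  · rw [hneg]
    exact (Set.disjoint_image_iff φ.injective).2 hD.2.2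

variable [Finite H]

lemma ncard_inter (hD : IsSkewHadamard D) {h : H} (hh : h ≠ 0) :
    4 * {x : H | x ∈ D ∧ x + h ∈ D}.ncard + 3 = Nat.card H := by
  obtain ⟨v, k, l, hv⟩ := hD.1
  rw [← ncard_differences, hv.2.2 h hh]
  exact hD.isSkew.ncard_inter_of_isDifferenceSet hv hh

/-- Two skew Hadamard difference sets that are translates of each other are equal. -/
lemma eq_zero_of_translate (hD : IsSkewHadamard D) (hc : 3 < Nat.card H) (ho : Odd (Nat.card H))
    {h : H} (hD' : IsSkew ((fun d => d + h) '' D)) : h = 0 := by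
  by_contra hh
  have hmem : ∀ x, x ∈ (fun d => d + h) '' D ↔ x - h ∈ D := by
    intro x
    constructor
    · rintro ⟨y, hy, rfl⟩
      simpa using hy
    · intro hx
      exact ⟨x - h, hx, by simp⟩
  have h2 : h + h ≠ 0 := by
    intro h2
    have h3 : addOrderOf h ∣ 2 := addOrderOf_dvd_of_nsmul_eq_zero (by rw [two_nsmul, h2])
    have h4 : addOrderOf h ∣ Nat.card H := addOrderOf_dvd_natCard h
    have h5 : addOrderOf h ∣ 1 := by
      rw [← Nat.Coprime.gcd_eq_one (Nat.coprime_two_left.2 ho)]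
      exact Nat.dvd_gcd h3 h4
    exact hh (AddMonoid.addOrderOf_eq_one_iff.1 (Nat.dvd_one.1 h5))
  -- every element of `D` but possibly one stays in `D` under the translation by `2h`
  have hsub : D ⊆ {x | x ∈ D ∧ x + (h + h) ∈ D} ∪ {-(h + h)} := by
    intro x hx
    by_cases h8 : x + (h + h) = 0
    · exact Or.inr (eq_neg_of_add_eq_zero_left h8)
    refine Or.inl ⟨hx, ?_⟩
    have h5 : x + h ∈ (fun d => d + h) '' D := ⟨x, hx, rfl⟩
    have h6 : x + h ≠ 0 := fun h' => hD'.zero_notMem (h' ▸ h5)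
    have h7 : -(x + h) ∉ (fun d => d + h) '' D := by
      rw [hD'.neg_mem_iff h6, not_not]
      exact h5
    rw [hmem, show -(x + h) - h = -(x + (h + h)) by abel, hD.isSkew.neg_mem_iff h8, not_not] at h7
    exact h7
  -- The inclusion gives at least |D| - 1 = (|H| - 3)/2 elements, but the difference set property
  -- allows only (|H| - 3)/4.
  have h9 := (Set.ncard_le_ncard hsub (Set.toFinite _)).trans (Set.ncard_union_le _ _)
  rw [Set.ncard_singleton] at h9
  have h10 := hD.ncard_inter h2
  have h11 := hD.isSkew.two_mul_ncard
  omega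

lemma eq_zero_of_translate_eq (hD : IsSkewHadamard D) (hc : 3 < Nat.card H)
    (ho : Odd (Nat.card H)) {h h' : H}
    (he : (fun d => d + h) '' D = (fun d => d + h') '' D) : h = h' := by
  have h1 : (fun d => d + (h - h')) '' D = D := by
    have h2 : (fun d => d + (h - h')) '' D = (fun d => d + (-h')) '' ((fun d => d + h) '' D) := by
      rw [Set.image_image]
      congr 1
      ext d
      rw [sub_eq_add_neg, add_assoc]
    rw [h2, he, Set.image_image]
    simp
  rw [← sub_eq_zero]
  exact hD.eq_zero_of_translate hc ho (by rw [h1]; exact hD.isSkew)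

/-- The translation design of a skew Hadamard difference set is a symmetric design. -/
lemma isSymmetricDesign (hD : IsSkewHadamard D) (hc : 3 < Nat.card H) (ho : Odd (Nat.card H)) :
    IsSymmetricDesign (translationDesign D) (Nat.card H) ((Nat.card H - 1) / 2)
      ((Nat.card H - 3) / 4) where
  card_points := rfl
  card_blocks := by
    have h1 : translationDesign D = Set.range (fun h : H => (fun d => d + h) '' D) := by
      ext B
      exact ⟨fun ⟨h, hB⟩ => ⟨h, hB.symm⟩, fun ⟨h, hB⟩ => ⟨h, hB.symm⟩⟩
    rw [h1, ← Set.image_univ, Set.ncard_image_of_injective _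
      (fun h h' he => hD.eq_zero_of_translate_eq hc ho he), Set.ncard_univ]
  card_block := by
    rintro _ ⟨h, rfl⟩
    rw [Set.ncard_image_of_injective _ (add_left_injective h), ← hD.isSkew.two_mul_ncard]
    omega
  card_pair := by
    intro x y hxy
    -- A block through x is labelled by the element z of D that is translated to x; it passes
    -- through y iff z + (y - x) lies in D.
    have h1 : {B ∈ translationDesign D | x ∈ B ∧ y ∈ B} =
        (fun z : H => (fun d => d + (x - z)) '' D) '' {z | z ∈ D ∧ z + (y - x) ∈ D} := by
      ext B
      simp only [Set.mem_ofPred_eq, Set.mem_image]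
      constructor
      · rintro ⟨⟨h, rfl⟩, ⟨d, hd, rfl⟩, e, he, rfl⟩
        exact ⟨d, ⟨hd, by simpa using he⟩, by simp⟩
      · rintro ⟨z, ⟨hz, hz'⟩, rfl⟩
        exact ⟨⟨_, rfl⟩, ⟨z, hz, by simp⟩, _, hz', by change z + (y - x) + (x - z) = y; abel⟩
    rw [h1, Set.ncard_image_of_injective]
    · have := hD.ncard_inter (sub_ne_zero.2 hxy.symm)
      omega
    · intro z z' he
      simpa using hD.eq_zero_of_translate_eq hc ho he

/-- Distinct skew Hadamard difference sets generate distinct translation designs. -/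
lemma eq_of_mem_translationDesign (hD : IsSkewHadamard D) (hc : 3 < Nat.card H)
    (ho : Odd (Nat.card H)) {D' : Set H} (hD' : IsSkewHadamard D')
    (h : D' ∈ translationDesign D) : D' = D := by
  obtain ⟨h, rfl⟩ := h
  rw [hD.eq_zero_of_translate hc ho hD'.isSkew]
  simp

end IsSkewHadamard

end DifferenceSets

/-! ### The group `A` and its normalizer -/

section Normalizer

variable {F : Type*} [Field F]

/-- The additive endomorphism underlying `semilin`. -/
def semilinHom (τ : F ≃+* F) (k s : Fˣ) (m : F) (L : F →+ F) : (Fin 3 → F) →+ (Fin 3 → F) where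
  toFun v := ![k * s ^ 2 * τ (v 0) + m * s * τ (v 1) + L (v 2), k * s * τ (v 1) + m * τ (v 2),
    k * τ (v 2)]
  map_zero' := by ext i; fin_cases i <;> simp
  map_add' v w := by ext i; fin_cases i <;> simp <;> ring

lemma semilinHom_injective (τ : F ≃+* F) (k s : Fˣ) (m : F) (L : F →+ F) :
    Function.Injective (semilinHom τ k s m L) := by
  rw [injective_iff_map_eq_zero]
  intro v hv
  have h2 : (k : F) * τ (v 2) = 0 := congrFun hv 2
  have h2' : v 2 = 0 := by simpa using h2
  have h1 : (k : F) * s * τ (v 1) + m * τ (v 2) = 0 := congrFun hv 1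
  have h1' : v 1 = 0 := by simpa [h2'] using h1
  have h0 : (k : F) * s ^ 2 * τ (v 0) + m * s * τ (v 1) + L (v 2) = 0 := congrFun hv 0
  have h0' : v 0 = 0 := by simpa [h2', h1'] using h0
  ext i
  fin_cases i <;> assumption

variable [Finite F]

/-- The automorphism
`(a, b, c) ↦ (k s² τ(a) + m s τ(b) + L(c), k s τ(b) + m τ(c), k τ(c))`. -/
noncomputable def semilin (τ : F ≃+* F) (k s : Fˣ) (m : F) (L : F →+ F) : AutV F :=
  LinearEquiv.ofBijective (semilinHom τ k s m L).toIntLinearMap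
    ⟨semilinHom_injective τ k s m L,
      Finite.injective_iff_surjective.1 (semilinHom_injective τ k s m L)⟩

lemma semilin_apply (τ : F ≃+* F) (k s : Fˣ) (m : F) (L : F →+ F) (v : Fin 3 → F) :
    semilin τ k s m L v = ![k * s ^ 2 * τ (v 0) + m * s * τ (v 1) + L (v 2),
      k * s * τ (v 1) + m * τ (v 2), k * τ (v 2)] := rfl

/-- The automorphism `semilin` in the case where `L` is `τ`-semilinear. -/
noncomputable def nrm (τ : F ≃+* F) (k s : Fˣ) (m l : F) : AutV F :=
  semilin τ k s m ((AddMonoidHom.mulLeft l).comp τ.toAddEquiv.toAddMonoidHom)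

lemma nrm_apply (τ : F ≃+* F) (k s : Fˣ) (m l : F) (v : Fin 3 → F) :
    nrm τ k s m l v = ![k * s ^ 2 * τ (v 0) + m * s * τ (v 1) + l * τ (v 2),
      k * s * τ (v 1) + m * τ (v 2), k * τ (v 2)] := rfl

/-- The automorphism given by the matrix `E(x)`. -/
noncomputable def eAut (x : F) : AutV F := nrm (RingEquiv.refl F) 1 1 x (x ^ 2 / 2)

lemma eAut_apply (x : F) (v : Fin 3 → F) :
    eAut x v = ![v 0 + x * v 1 + x ^ 2 / 2 * v 2, v 1 + x * v 2, v 2] := by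
  simp [eAut, nrm_apply]

/-- The scalar automorphism. -/
noncomputable def sAut (s : Fˣ) : AutV F := nrm (RingEquiv.refl F) s 1 0 0

lemma sAut_apply (s : Fˣ) (v : Fin 3 → F) : sAut s v = (s : F) • v := by
  ext i
  fin_cases i <;> simp [sAut, nrm_apply]

lemma eAut_apply_mulVec (x : F) (v : Fin 3 → F) : eAut x v = (matE x).mulVec v := by
  rw [eAut_apply]
  ext i
  fin_cases i <;> simp [matE, Matrix.mulVec, dotProduct, Fin.sum_univ_three]

lemma two_ne_zero_of_odd (hF : Odd (Nat.card F)) : (2 : F) ≠ 0 := by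
  have := Fintype.ofFinite F
  apply Ring.two_ne_zero
  intro h
  have := FiniteField.even_card_of_char_two h
  rw [← Nat.card_eq_fintype_card] at this
  rcases hF with ⟨r, hr⟩
  omega

lemma eAut_mul (h2 : (2 : F) ≠ 0) (x y : F) : (eAut x * eAut y : AutV F) = eAut (x + y) := by
  ext v i
  rw [LinearEquiv.mul_apply]
  fin_cases i <;> simp [eAut_apply] <;> field_simp <;> ring

lemma eAut_zero : (eAut 0 : AutV F) = 1 := by
  ext v i
  fin_cases i <;> simp [eAut_apply]

lemma eAut_inv (h2 : (2 : F) ≠ 0) (x : F) : (eAut x : AutV F)⁻¹ = eAut (-x) := by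
  rw [inv_eq_iff_mul_eq_one, eAut_mul h2, add_neg_cancel, eAut_zero]

lemma eAut_pow (h2 : (2 : F) ≠ 0) (x : F) (n : ℕ) : (eAut x : AutV F) ^ n = eAut (n * x) := by
  induction n with
  | zero => simp [eAut_zero]
  | succ n ih => rw [pow_succ, ih, eAut_mul h2]; congr 1; push_cast; ring

lemma eAut_injective : Function.Injective (eAut : F → AutV F) := by
  intro x y h
  have := congrFun (DFunLike.congr_fun h ![0, 0, 1]) 1
  simpa [eAut_apply] using this

lemma sAut_mul (s t : Fˣ) : (sAut s * sAut t : AutV F) = sAut (s * t) := by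
  ext v i
  simp [LinearEquiv.mul_apply, sAut_apply, mul_assoc]

lemma sAut_one : (sAut 1 : AutV F) = 1 := by
  ext v i
  simp [sAut_apply]

lemma sAut_inv (s : Fˣ) : (sAut s : AutV F)⁻¹ = sAut s⁻¹ := by
  rw [inv_eq_iff_mul_eq_one, sAut_mul, mul_inv_cancel, sAut_one]

lemma sAut_pow (s : Fˣ) (n : ℕ) : (sAut s : AutV F) ^ n = sAut (s ^ n) := by
  induction n with
  | zero => simp [sAut_one]
  | succ n ih => rw [pow_succ, ih, sAut_mul, pow_succ]

lemma sAut_mul_eAut (s : Fˣ) (x : F) : (sAut s * eAut x : AutV F) = eAut x * sAut s := by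
  ext v i
  simp only [LinearEquiv.mul_apply, sAut_apply, eAut_apply]
  fin_cases i <;> simp <;> ring

lemma sAut_mul_eAut_injective {s t : Fˣ} {x y : F}
    (h : (sAut s * eAut x : AutV F) = sAut t * eAut y) : s = t ∧ x = y := by
  have h0 := DFunLike.congr_fun h ![0, 0, 1]
  simp only [LinearEquiv.mul_apply, sAut_apply, eAut_apply] at h0
  have h1 := congrFun h0 2
  have h2 := congrFun h0 1
  simp at h1 h2
  refine ⟨Units.ext h1, ?_⟩
  rw [h1] at h2
  exact mul_left_cancel₀ t.ne_zero h2

lemma mem_groupE (h2 : (2 : F) ≠ 0) {g : AutV F} : g ∈ groupE F ↔ ∃ x, g = eAut x := by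
  constructor
  · intro h
    induction h using Subgroup.closure_induction with
    | mem g hg =>
      obtain ⟨x, hx⟩ := hg
      exact ⟨x, LinearEquiv.ext fun v => by rw [hx, eAut_apply_mulVec]⟩
    | one => exact ⟨0, eAut_zero.symm⟩
    | mul g h _ _ hg hh =>
      obtain ⟨x, rfl⟩ := hg
      obtain ⟨y, rfl⟩ := hh
      exact ⟨_, eAut_mul h2 _ _⟩
    | inv g _ hg =>
      obtain ⟨x, rfl⟩ := hg
      exact ⟨_, eAut_inv h2 _⟩
  · rintro ⟨x, rfl⟩
    exact Subgroup.subset_closure ⟨x, fun v => eAut_apply_mulVec x v⟩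

lemma mem_groupS {g : AutV F} : g ∈ groupS F ↔ ∃ s : Fˣ, IsSquare s ∧ g = sAut s := by
  constructor
  · intro h
    induction h using Subgroup.closure_induction with
    | mem g hg =>
      obtain ⟨s, hs, ⟨r, rfl⟩, hx⟩ := hg
      have hr : r ≠ 0 := fun h => hs (by simp [h])
      exact ⟨Units.mk0 r hr * Units.mk0 r hr, ⟨_, rfl⟩,
        LinearEquiv.ext fun v => by rw [hx, sAut_apply]; simp⟩
    | one => exact ⟨1, IsSquare.one, sAut_one.symm⟩
    | mul g h _ _ hg hh =>
      obtain ⟨x, hx, rfl⟩ := hg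
      obtain ⟨y, hy, rfl⟩ := hh
      exact ⟨_, hx.mul hy, sAut_mul _ _⟩
    | inv g _ hg =>
      obtain ⟨x, hx, rfl⟩ := hg
      exact ⟨_, hx.inv, sAut_inv _⟩
  · rintro ⟨s, ⟨r, rfl⟩, rfl⟩
    exact Subgroup.subset_closure ⟨_, (r * r).ne_zero, ⟨r, by simp⟩, fun v => sAut_apply _ v⟩

lemma mem_groupA (h2 : (2 : F) ≠ 0) {g : AutV F} :
    g ∈ groupA F ↔ ∃ s : Fˣ, ∃ x : F, IsSquare s ∧ g = sAut s * eAut x := by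
  constructor
  · intro h
    unfold groupA at h
    rw [Subgroup.sup_eq_closure] at h
    induction h using Subgroup.closure_induction with
    | mem g hg =>
      rcases hg with hg | hg
      · obtain ⟨x, rfl⟩ := (mem_groupE h2).1 hg
        exact ⟨1, x, IsSquare.one, by rw [sAut_one, one_mul]⟩
      · obtain ⟨s, hs, rfl⟩ := mem_groupS.1 hg
        exact ⟨s, 0, hs, by rw [eAut_zero, mul_one]⟩
    | one => exact ⟨1, 0, IsSquare.one, by rw [sAut_one, one_mul, eAut_zero]⟩
    | mul g h _ _ hg hh =>
      obtain ⟨s, x, hs, rfl⟩ := hg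
      obtain ⟨t, y, ht, rfl⟩ := hh
      refine ⟨s * t, x + y, hs.mul ht, ?_⟩
      rw [← sAut_mul, ← eAut_mul h2, mul_assoc, ← mul_assoc (eAut x), ← sAut_mul_eAut,
        mul_assoc, mul_assoc]
    | inv g _ hg =>
      obtain ⟨s, x, hs, rfl⟩ := hg
      refine ⟨s⁻¹, -x, hs.inv, ?_⟩
      rw [mul_inv_rev, sAut_inv, eAut_inv h2, sAut_mul_eAut]
  · rintro ⟨s, x, hs, rfl⟩
    exact mul_mem (Subgroup.mem_sup_right (mem_groupS.2 ⟨s, hs, rfl⟩))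
      (Subgroup.mem_sup_left ((mem_groupE h2).2 ⟨x, rfl⟩))

/-- `L` reads only the last coordinate, which E(x) fixes, and writes only to the first, on which E
acts trivially. So normalizing E puts no condition on `L`. -/
lemma semilin_mul_eAut (h2 : (2 : F) ≠ 0) (τ : F ≃+* F) (k s : Fˣ) (m : F) (L : F →+ F) (x : F) :
    semilin τ k s m L * eAut x = eAut (s * τ x) * semilin τ k s m L := by
  ext v i
  simp only [LinearEquiv.mul_apply, semilin_apply, eAut_apply]
  have h3 : τ 2 = 2 := map_ofNat τ 2
  fin_cases i <;> simp [h3] <;> field_simp <;> ring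

lemma nrm_mul_sAut (τ : F ≃+* F) (k s : Fˣ) (m l : F) (t : Fˣ) :
    nrm τ k s m l * sAut t = sAut (Units.map τ.toMonoidHom t) * nrm τ k s m l := by
  ext v i
  simp only [LinearEquiv.mul_apply, nrm_apply, sAut_apply]
  fin_cases i <;> simp <;> ring

/-- An automorphism conjugating each `E(x)` into `E` is of the form `semilin`. -/
lemma exists_eq_semilin (h2 : (2 : F) ≠ 0) {φ : AutV F}
    (h : ∀ x, ∃ y, φ * eAut x = eAut y * φ) :
    ∃ (τ : F ≃+* F) (k s : Fˣ) (m : F) (L : F →+ F), φ = semilin τ k s m L := by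
  choose σ hσ using h
  -- This is φ(E(x) - 1) = (E(σ x) - 1)φ. Since E(x) - 1 is nilpotent, it yields the triangular
  -- shape of φ one coordinate at a time.
  have star : ∀ x a b c, φ ![x * b + x ^ 2 / 2 * c, x * c, 0] =
      ![σ x * φ ![a, b, c] 1 + σ x ^ 2 / 2 * φ ![a, b, c] 2, σ x * φ ![a, b, c] 2, 0] := by
    intro x a b c
    have h1 := DFunLike.congr_fun (hσ x) ![a, b, c]
    rw [LinearEquiv.mul_apply, LinearEquiv.mul_apply, eAut_apply, eAut_apply] at h1
    have h3 : ![x * b + x ^ 2 / 2 * c, x * c, 0] =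
        ![a + x * b + x ^ 2 / 2 * c, b + x * c, c] - ![a, b, c] := by
      ext i; fin_cases i <;> simp; ring
    have h4 : φ ![a + x * b + x ^ 2 / 2 * c, b + x * c, c] =
        ![φ ![a, b, c] 0 + σ x * φ ![a, b, c] 1 + σ x ^ 2 / 2 * φ ![a, b, c] 2,
          φ ![a, b, c] 1 + σ x * φ ![a, b, c] 2, φ ![a, b, c] 2] := h1
    rw [h3, map_sub, h4]
    ext i; fin_cases i <;> simp; ring
  have hs : σ 1 ≠ 0 := by
    intro h0
    have h1 := hσ 1
    rw [h0, eAut_zero, one_mul, mul_eq_left, ← eAut_zero] at h1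
    exact one_ne_zero (eAut_injective h1)
  have hadd : ∀ a b c a' b' c', φ ![a + a', b + b', c + c'] = φ ![a, b, c] + φ ![a', b', c'] := by
    intro a b c a' b' c'
    rw [← map_add]
    congr 1
    ext i; fin_cases i <;> simp
  have hz : φ ![0, 0, 0] = 0 := by
    rw [show (![0, 0, 0] : Fin 3 → F) = 0 by ext i; fin_cases i <;> simp, map_zero]
  have a2 : ∀ a, φ ![a, 0, 0] 2 = 0 := fun a => by
    have h1 := congrFun (star 1 a 0 0) 1
    simpa [hz, hs] using h1
  have a1 : ∀ a, φ ![a, 0, 0] 1 = 0 := fun a => by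
    have h1 := congrFun (star 1 a 0 0) 0
    simpa [hz, hs, a2] using h1
  have b2 : ∀ b, φ ![0, b, 0] 2 = 0 := fun b => by
    have h1 := congrFun (star 1 0 b 0) 1
    simpa [a1, hs] using h1
  have ab : ∀ x b, φ ![x * b, 0, 0] 0 = σ x * φ ![0, b, 0] 1 := fun x b => by
    have h1 := congrFun (star x 0 b 0) 0
    simpa [b2] using h1
  have bc : ∀ x c, φ ![0, x * c, 0] 1 = σ x * φ ![0, 0, c] 2 := fun x c => by
    have h1 := congrFun (star x 0 0 c) 1
    have h3 := hadd (x * 0 + x ^ 2 / 2 * c) 0 0 0 (x * c) 0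
    simp only [add_zero, zero_add] at h3
    simp only [mul_zero, zero_add] at h1 h3
    rw [h3] at h1
    simpa [a1] using h1
  have chalf : ∀ c, φ ![0, 0, c / 2] 2 = φ ![0, 0, c] 2 / 2 := fun c => by
    have h3 := congrFun (hadd 0 0 (c / 2) 0 0 (c / 2)) 2
    rw [show c / 2 + c / 2 = c by field_simp; ring] at h3
    simp only [add_zero, Pi.add_apply] at h3
    rw [h3, ← two_mul]
    field_simp
  -- The quadratic terms x²c/2 and σ(x)²/2 on the two sides of `star` cancel by `ab`, `bc` and
  -- `chalf`.
  have km : ∀ x c, φ ![0, x * c, 0] 0 = σ x * φ ![0, 0, c] 1 := fun x c => by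
    have h1 := congrFun (star x 0 0 c) 0
    have h3 := hadd (x * (x * (c / 2))) 0 0 0 (x * c) 0
    simp only [add_zero, zero_add] at h3
    rw [show x * 0 + x ^ 2 / 2 * c = x * (x * (c / 2)) by ring, h3, Pi.add_apply, ab, bc,
      chalf] at h1
    simp only [Matrix.cons_val_zero] at h1
    linear_combination h1
  have cinj : ∀ c, φ ![0, 0, c] 2 = 0 → c = 0 := fun c hc => by
    have h1 : φ ![1 * (1 * c), 0, 0] 0 = 0 := by rw [ab, bc, hc]; simp
    have h3 : φ ![c, 0, 0] = 0 := by
      rw [one_mul, one_mul] at h1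
      ext i; fin_cases i
      · exact h1
      · exact a1 c
      · exact a2 c
    exact congrFun ((map_eq_zero_iff φ φ.injective).1 h3) 0
  set k := φ ![0, 0, 1] 2 with hk
  have hk0 : k ≠ 0 := fun h => one_ne_zero (cinj 1 h)
  have hσC : ∀ x, σ x * k = σ 1 * φ ![0, 0, x] 2 := fun x => by
    rw [← bc, ← bc, one_mul, mul_one]
  -- The middle coordinate of φ(0, xc, 0) is evaluated in two ways. After division by k this becomes
  -- multiplicativity of the sought field automorphism.
  have hCmul : ∀ x c, φ ![0, 0, x * c] 2 * k = φ ![0, 0, x] 2 * φ ![0, 0, c] 2 := fun x c => by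
    have h1 := bc 1 (x * c)
    rw [one_mul, bc] at h1
    apply mul_left_cancel₀ hs
    linear_combination (-k) * h1 + φ ![0, 0, c] 2 * hσC x
  let τ₀ : F →+* F :=
    { toFun := fun c => φ ![0, 0, c] 2 / k
      map_one' := div_self hk0
      map_zero' := by simp [hz]
      map_mul' := fun x c => by
        rw [div_mul_div_comm, ← hCmul]
        field_simp
      map_add' := fun x c => by
        have := congrFun (hadd 0 0 x 0 0 c) 2
        simp only [add_zero, Pi.add_apply] at this
        rw [this, add_div] }
  let τ : F ≃+* F := RingEquiv.ofBijective τ₀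
    ⟨τ₀.injective, Finite.injective_iff_surjective.1 τ₀.injective⟩
  have hτ : ∀ c, φ ![0, 0, c] 2 = k * τ c := fun c => by
    change _ = k * (φ ![0, 0, c] 2 / k)
    field_simp
  have hστ : ∀ x, σ x = σ 1 * τ x := fun x => by
    apply mul_right_cancel₀ hk0
    rw [hσC, hτ]; ring
  let L : F →+ F :=
    { toFun := fun c => φ ![0, 0, c] 0
      map_zero' := by simp [hz]
      map_add' := fun x c => by
        have := congrFun (hadd 0 0 x 0 0 c) 0
        simpa only [add_zero, Pi.add_apply] using this }
  refine ⟨τ, Units.mk0 k hk0, Units.mk0 (σ 1) hs, φ ![0, 0, 1] 1, L, ?_⟩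
  have hB : ∀ b, φ ![0, b, 0] 1 = k * σ 1 * τ b := fun b => by
    have := bc 1 b
    rw [one_mul, hτ] at this
    rw [this]; ring
  have hA : ∀ a, φ ![a, 0, 0] 0 = k * σ 1 ^ 2 * τ a := fun a => by
    have := ab 1 a
    rw [one_mul, hB] at this
    rw [this]; ring
  have hK : ∀ b, φ ![0, b, 0] 0 = φ ![0, 0, 1] 1 * σ 1 * τ b := fun b => by
    have := km b 1
    rw [mul_one, hστ] at this
    rw [this]; ring
  have hM : ∀ c, φ ![0, 0, c] 1 = φ ![0, 0, 1] 1 * τ c := fun c => by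
    have := km 1 c
    rw [one_mul, hK] at this
    apply mul_left_cancel₀ hs
    linear_combination -this
  ext v i
  have hv : φ v = φ ![v 0, 0, 0] + φ ![0, v 1, 0] + φ ![0, 0, v 2] := by
    rw [← hadd, ← hadd]
    congr 1
    ext i; fin_cases i <;> simp
  rw [hv, semilin_apply]
  fin_cases i
  · simp [hA, hK, L]
  · simp [a1, hB, hM (v 2)]
  · simp [a2, b2, hτ]

lemma natCast_card_eq_zero : ((Nat.card F : ℕ) : F) = 0 := by
  have := Fintype.ofFinite F
  rw [Nat.card_eq_fintype_card]
  exact FiniteField.cast_card_eq_zero F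

lemma units_pow_card_sub_one (t : Fˣ) : t ^ (Nat.card F - 1) = 1 := by
  have := Fintype.ofFinite F
  ext
  rw [Nat.card_eq_fintype_card]
  push_cast
  exact FiniteField.pow_card_sub_one_eq_one _ t.ne_zero

lemma units_pow_card (t : Fˣ) : t ^ Nat.card F = t := by
  have h : Nat.card F = (Nat.card F - 1) + 1 := (Nat.sub_add_cancel Nat.card_pos).symm
  rw [h, pow_succ, units_pow_card_sub_one, one_mul]

lemma sAut_mul_eAut_pow (h2 : (2 : F) ≠ 0) (t : Fˣ) (y : F) (n : ℕ) :
    (sAut t * eAut y : AutV F) ^ n = sAut (t ^ n) * eAut (n * y) := by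
  rw [Commute.mul_pow (sAut_mul_eAut t y), sAut_pow, eAut_pow h2]

/-- Every c is the difference of the squares of (c+1)/2 and (c-1)/2, so semilinearity over squares
extends to all scalars. -/
lemma semilin_eq_nrm (h2 : (2 : F) ≠ 0) {τ : F ≃+* F} {k s : Fˣ} {m : F} {L : F →+ F}
    (h : ∀ r c, L (r * r * c) = τ (r * r) * L c) : semilin τ k s m L = nrm τ k s m (L 1) := by
  have hL : ∀ c, L c = L 1 * τ c := by
    intro c
    have h1 : c = (c + 1) / 2 * ((c + 1) / 2) * 1 - (c - 1) / 2 * ((c - 1) / 2) * 1 := by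
      field_simp; ring
    have h3 : τ c = τ ((c + 1) / 2 * ((c + 1) / 2)) - τ ((c - 1) / 2 * ((c - 1) / 2)) := by
      rw [← map_sub]; congr 1; linear_combination h1
    conv_lhs => rw [h1]
    rw [map_sub, h, h, h3]
    ring
  ext v i
  rw [semilin_apply, nrm_apply, hL (v 2)]

lemma mem_normalizer_groupA (h2 : (2 : F) ≠ 0) {φ : AutV F} :
    φ ∈ Subgroup.normalizer (groupA F : Set (AutV F)) ↔
      ∃ (τ : F ≃+* F) (k s : Fˣ) (m l : F), φ = nrm τ k s m l := by
  constructor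
  · intro h
    rw [Subgroup.mem_normalizer_iff] at h
    have hE : ∀ x, ∃ y, φ * eAut x = eAut y * φ := by
      intro x
      obtain ⟨t, y, -, hy⟩ := (mem_groupA h2).1 ((h (eAut x)).1
        ((mem_groupA h2).2 ⟨1, x, IsSquare.one, by rw [sAut_one, one_mul]⟩))
      -- The q-th power kills E and fixes every scalar, so the scalar component t is 1.
      have h1 := congrArg (· ^ Nat.card F) hy
      simp only [conj_pow, eAut_pow h2, sAut_mul_eAut_pow h2, natCast_card_eq_zero, zero_mul,
        eAut_zero, mul_one, mul_inv_cancel, units_pow_card] at h1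
      rw [← h1, one_mul] at hy
      exact ⟨y, by rw [← hy]; group⟩
    obtain ⟨τ, k, s, m, L, rfl⟩ := exists_eq_semilin h2 hE
    refine ⟨τ, k, s, m, L 1, semilin_eq_nrm h2 fun r c => ?_⟩
    by_cases hr : r = 0
    · simp [hr]
    set u := Units.mk0 r hr with hu
    obtain ⟨t, y, -, hy⟩ := (mem_groupA h2).1 ((h (sAut (u * u))).1
        ((mem_groupA h2).2 ⟨u * u, 0, ⟨u, rfl⟩, by rw [eAut_zero, mul_one]⟩))
    -- The (q-1)-st power kills all scalars and turns E(y) into E(-y), so y = 0.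
    have h1 := congrArg (· ^ (Nat.card F - 1)) hy
    simp only [conj_pow, sAut_pow, units_pow_card_sub_one, sAut_mul_eAut_pow h2, sAut_one,
      mul_one, mul_inv_cancel, one_mul] at h1
    rw [← eAut_zero] at h1
    have h3 := eAut_injective h1
    rw [Nat.cast_sub Nat.card_pos, natCast_card_eq_zero] at h3
    have h4 : y = 0 := by simpa using h3.symm
    rw [h4, eAut_zero, mul_one, mul_inv_eq_iff_eq_mul] at hy
    -- The first coordinate gives L(r²c) = t L(c); the last one, at c = 1, identifies t with τ(r²).
    have h5 := DFunLike.congr_fun hy ![0, 0, c]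
    simp only [LinearEquiv.mul_apply, sAut_apply, semilin_apply] at h5
    have h6 := congrFun h5 2
    have h7 := congrFun h5 0
    have h8 := congrFun (DFunLike.congr_fun hy ![0, 0, 1]) 2
    simp [LinearEquiv.mul_apply, sAut_apply, semilin_apply, hu] at h6 h7 h8
    have h9 : (t : F) = τ r * τ r := mul_right_cancel₀ k.ne_zero (by linear_combination -h8)
    rw [h7, map_mul, h9]
  · rintro ⟨τ, k, s, m, l, rfl⟩
    have : Finite (AutV F) := DFunLike.finite _
    -- By finiteness it is enough that conjugation maps A into itself.
    apply Subgroup.mem_normalizer_fintype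
    intro g hg
    obtain ⟨t, x, ht, rfl⟩ := (mem_groupA h2).1 hg
    refine (mem_groupA h2).2 ⟨Units.map τ.toMonoidHom t, s * τ x, ht.map _, ?_⟩
    rw [← mul_assoc, nrm_mul_sAut, mul_assoc (sAut _), nrm, semilin_mul_eAut h2, ← mul_assoc,
      mul_inv_cancel_right]

lemma nrm_injective {τ τ' : F ≃+* F} {k s k' s' : Fˣ} {m l m' l' : F}
    (h : nrm τ k s m l = nrm τ' k' s' m' l') : τ = τ' ∧ k = k' ∧ s = s' ∧ m = m' ∧ l = l' := by
  have h0 := fun v => DFunLike.congr_fun h v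
  simp only [nrm_apply] at h0
  have hk := congrFun (h0 ![0, 0, 1]) 2
  have hm := congrFun (h0 ![0, 0, 1]) 1
  have hl := congrFun (h0 ![0, 0, 1]) 0
  have hs := congrFun (h0 ![0, 1, 0]) 1
  simp at hk hm hl hs
  refine ⟨RingEquiv.ext fun c => ?_, Units.ext hk, ?_, hm, hl⟩
  · have hc := congrFun (h0 ![0, 0, c]) 2
    simpa [hk] using hc
  · rw [hk] at hs
    exact Units.ext (mul_left_cancel₀ k'.ne_zero hs)

/-! ### Order of the normalizer and index of A -/

lemma card_units_eq : Nat.card Fˣ = Nat.card F - 1 := by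
  have := Fintype.ofFinite F
  classical
  rw [Nat.card_eq_fintype_card, Nat.card_eq_fintype_card, Fintype.card_units]

lemma card_normalizer_groupA (h2 : (2 : F) ≠ 0) :
    Nat.card (Subgroup.normalizer (groupA F : Set (AutV F))) =
      Nat.card (F ≃+* F) * (Nat.card F - 1) ^ 2 * Nat.card F ^ 2 := by
  let f : (F ≃+* F) × Fˣ × Fˣ × F × F → Subgroup.normalizer (groupA F : Set (AutV F)) :=
    fun x => ⟨nrm x.1 x.2.1 x.2.2.1 x.2.2.2.1 x.2.2.2.2, (mem_normalizer_groupA h2).2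
      ⟨_, _, _, _, _, rfl⟩⟩
  have hf : Function.Bijective f := by
    constructor
    · rintro ⟨τ, k, s, m, l⟩ ⟨τ', k', s', m', l'⟩ h
      obtain ⟨rfl, rfl, rfl, rfl, rfl⟩ := nrm_injective (Subtype.ext_iff.1 h)
      rfl
    · rintro ⟨φ, hφ⟩
      obtain ⟨τ, k, s, m, l, rfl⟩ := (mem_normalizer_groupA h2).1 hφ
      exact ⟨⟨τ, k, s, m, l⟩, rfl⟩
  rw [← Nat.card_congr (Equiv.ofBijective f hf)]
  simp only [Nat.card_prod, card_units_eq]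
  ring

/-- The squares are the image of the squaring map, whose kernel is {1, -1}. -/
lemma two_mul_card_square_units (h2 : (2 : F) ≠ 0) :
    2 * Nat.card {s : Fˣ // IsSquare s} = Nat.card F - 1 := by
  have h1 := Subgroup.card_mul_index (powMonoidHom 2 : Fˣ →* Fˣ).ker
  rw [Subgroup.index_ker, card_units_eq] at h1
  rw [← h1]
  congr 1
  · have h3 : ((powMonoidHom 2 : Fˣ →* Fˣ).ker : Set Fˣ) = {1, -1} := by
      ext s
      simp only [SetLike.mem_coe, MonoidHom.mem_ker, powMonoidHom_apply, Set.mem_insert_iff,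
        Set.mem_singleton_iff, Units.ext_iff, Units.val_pow_eq_pow_val, Units.val_one,
        Units.val_neg]
      exact sq_eq_one_iff
    have h4 : (1 : Fˣ) ≠ -1 := by
      intro h
      apply h2
      have h5 : (1 : F) = -1 := by simpa using congrArg Units.val h
      linear_combination h5
    have h5 := Set.ncard_pair h4
    rw [← h3] at h5
    exact h5.symm
  · apply Nat.card_congr
    refine Equiv.subtypeEquivRight fun s => ?_
    rw [MonoidHom.mem_range]
    exact ⟨fun ⟨r, hr⟩ => ⟨r, by simp [hr, sq]⟩, fun ⟨r, hr⟩ => ⟨r, by rw [← hr]; simp [sq]⟩⟩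

lemma card_groupA (h2 : (2 : F) ≠ 0) :
    2 * Nat.card (groupA F) = (Nat.card F - 1) * Nat.card F := by
  let f : {s : Fˣ // IsSquare s} × F → groupA F :=
    fun x => ⟨sAut x.1.1 * eAut x.2, (mem_groupA h2).2 ⟨_, _, x.1.2, rfl⟩⟩
  have hf : Function.Bijective f := by
    constructor
    · rintro ⟨⟨s, hs⟩, x⟩ ⟨⟨t, ht⟩, y⟩ h
      obtain ⟨rfl, rfl⟩ := sAut_mul_eAut_injective (Subtype.ext_iff.1 h)
      rfl
    · rintro ⟨φ, hφ⟩
      obtain ⟨s, x, hs, rfl⟩ := (mem_groupA h2).1 hφ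
      exact ⟨⟨⟨s, hs⟩, x⟩, rfl⟩
  rw [← Nat.card_congr (Equiv.ofBijective f hf), Nat.card_prod, ← mul_assoc,
    two_mul_card_square_units h2]

lemma relIndex_groupA (h2 : (2 : F) ≠ 0) :
    (groupA F).relIndex (Subgroup.normalizer (groupA F : Set (AutV F))) =
      2 * Nat.card (F ≃+* F) * (Nat.card F - 1) * Nat.card F := by
  have h1 := Subgroup.card_mul_index
    ((groupA F).subgroupOf (Subgroup.normalizer (groupA F : Set (AutV F))))
  rw [card_normalizer_groupA h2, Nat.card_congr
    (Subgroup.subgroupOfEquivOfLe Subgroup.le_normalizer).toEquiv] at h1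
  have h3 := card_groupA h2
  have h4 : 0 < (Nat.card F - 1) * Nat.card F :=
    Nat.mul_pos (Nat.sub_pos_of_lt Finite.one_lt_card) Nat.card_pos
  apply Nat.eq_of_mul_eq_mul_left h4
  rw [Subgroup.relIndex, ← h3]
  rw [mul_assoc 2 (Nat.card _), h1]
  rw [h3]
  ring

/-- Ring automorphisms fix the prime field, so they form the Galois group of an extension of degree
n. -/
lemma card_ringAut {p n : ℕ} (hp : p.Prime) (hF : Nat.card F = p ^ n) :
    Nat.card (F ≃+* F) = n := by
  have := Fintype.ofFinite F
  have := Fact.mk hp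
  have hc : CharP F p := charP_of_card_eq_prime_pow (f := n) (by rw [← Nat.card_eq_fintype_card, hF])
  let _ : Algebra (ZMod p) F := ZMod.algebra F p
  have h1 : Nat.card (F ≃ₐ[ZMod p] F) = Module.finrank (ZMod p) F :=
    IsGalois.card_aut_eq_finrank (ZMod p) F
  have h3 : Module.finrank (ZMod p) F = n := by
    have h4 := Module.card_eq_pow_finrank (K := ZMod p) (V := F)
    rw [ZMod.card, ← Nat.card_eq_fintype_card, hF] at h4
    exact (Nat.pow_right_injective hp.two_le h4).symm
  rw [← h3, ← h1]
  exact Nat.card_congr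
    { toFun := fun f => AlgEquiv.ofRingEquiv (f := f) fun x =>
        DFunLike.congr_fun (Subsingleton.elim (f.toRingHom.comp (algebraMap (ZMod p) F))
          (algebraMap (ZMod p) F)) x
      invFun := fun f => f.toRingEquiv
      left_inv := fun f => rfl
      right_inv := fun f => rfl }

end Normalizer

/-! ### The `A`-invariant skew sets -/

section InvariantSets

lemma odd_card_of_card {F : Type*} (hF : Nat.card F % 4 = 3) : Odd (Nat.card F) :=
  Nat.odd_iff.2 (by omega)

lemma setSign_image {F : Type*} [Field F] {D D' : Set (Fin 3 → F)} {g : AutV F}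
    (h : g '' D = D') (v : Fin 3 → F) : setSign D' (g v) = setSign D v := by
  classical
  have h1 : ∀ v, g v ∈ D' ↔ v ∈ D := fun v => by
    rw [← h]
    exact g.injective.mem_set_image
  have h3 := h1 (-v)
  rw [map_neg] at h3
  unfold setSign
  congr 1 <;> simp only [h1, h3]

variable {F : Type*} [Field F] [Fintype F]

lemma ringChar_ne_two_of_card (hF : Nat.card F % 4 = 3) : ringChar F ≠ 2 := by
  intro h
  have := FiniteField.even_card_of_char_two h
  rw [← Nat.card_eq_fintype_card] at this
  omega

variable [DecidableEq F]

lemma quadraticChar_neg_of_card (hF : Nat.card F % 4 = 3) (x : F) :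
    quadraticChar F (-x) = -quadraticChar F x := by
  have h : quadraticChar F (-1) = -1 := by
    rw [quadraticChar_neg_one_iff_not_isSquare, FiniteField.isSquare_neg_one_iff,
      ← Nat.card_eq_fintype_card]
    simpa using hF
  rw [← neg_one_mul, map_mul, h, neg_one_mul]

/-- The odd `A`-invariant functions on `V` with values `±1` away from zero. -/
def invSign (α β : ℤˣ) (ε : F → ℤˣ) (v : Fin 3 → F) : ℤ :=
  if v 2 ≠ 0 then quadraticChar F (v 2) * ε ((v 1 ^ 2 - 2 * v 0 * v 2) / v 2 ^ 2)
  else if v 1 ≠ 0 then β * quadraticChar F (v 1)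
  else α * quadraticChar F (v 0)

/-- The `A`-invariant skew set with the given signs on the orbits of `A`. -/
def invSet (α β : ℤˣ) (ε : F → ℤˣ) : Set (Fin 3 → F) := {v | invSign α β ε v = 1}

variable {α β : ℤˣ} {ε : F → ℤˣ}

lemma invSign_neg (hF : Nat.card F % 4 = 3) (v : Fin 3 → F) :
    invSign α β ε (-v) = -invSign α β ε v := by
  simp only [invSign, Pi.neg_apply, neg_ne_zero, quadraticChar_neg_of_card hF]
  rw [show ((-v 1) ^ 2 - 2 * -v 0 * -v 2) / (-v 2) ^ 2 = (v 1 ^ 2 - 2 * v 0 * v 2) / v 2 ^ 2 by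
    ring]
  split_ifs <;> ring

lemma invSign_zero : invSign α β ε 0 = 0 := by
  simp [invSign]

lemma intUnit_mul_eq_one_or (u : ℤˣ) {z : ℤ} (hz : z = 1 ∨ z = -1) :
    (u : ℤ) * z = 1 ∨ (u : ℤ) * z = -1 := by
  rcases Int.units_eq_one_or u with rfl | rfl <;> rcases hz with rfl | rfl <;> simp

lemma invSign_eq_or {v : Fin 3 → F} (hv : v ≠ 0) :
    invSign α β ε v = 1 ∨ invSign α β ε v = -1 := by
  unfold invSign
  split_ifs with h2 h1
  · rw [mul_comm]
    exact intUnit_mul_eq_one_or _ (quadraticChar_dichotomy h2)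
  · exact intUnit_mul_eq_one_or _ (quadraticChar_dichotomy h1)
  · refine intUnit_mul_eq_one_or _ (quadraticChar_dichotomy fun h0 => hv ?_)
    ext i
    fin_cases i
    · exact h0
    · exact not_not.1 h1
    · exact not_not.1 h2

lemma isSkew_invSet (hF : Nat.card F % 4 = 3) : IsSkew (invSet α β ε) := by
  constructor
  · ext v
    simp only [invSet, Set.mem_union, Set.mem_neg, Set.mem_ofPred_eq, invSign_neg hF,
      Set.mem_compl_iff, Set.mem_singleton_iff]
    constructor
    · rintro h rfl
      rw [invSign_zero] at h
      omega
    · intro hv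
      rcases invSign_eq_or (α := α) (β := β) (ε := ε) hv with h | h <;> omega
  · rw [Set.disjoint_left]
    intro v hv hv'
    simp only [invSet, Set.mem_neg, Set.mem_ofPred_eq, invSign_neg hF] at hv hv'
    omega

lemma setSign_invSet (hF : Nat.card F % 4 = 3) (v : Fin 3 → F) :
    setSign (invSet α β ε) v = invSign α β ε v := by
  by_cases hv : v = 0
  · rw [hv, IsSkew.setSign_zero, invSign_zero]
  · simp only [setSign, invSet, Set.mem_ofPred_eq, invSign_neg hF]
    rcases invSign_eq_or (α := α) (β := β) (ε := ε) hv with h | h <;> simp [h]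

/-- E(x) preserves c and the form b² - 2ac; on c = 0 it also preserves b, and on b = c = 0 it
preserves a. -/
lemma invSign_eAut (h2 : (2 : F) ≠ 0) (x : F) (v : Fin 3 → F) :
    invSign α β ε (eAut x v) = invSign α β ε v := by
  rw [eAut_apply]
  by_cases hc : v 2 = 0
  · by_cases hb : v 1 = 0 <;> simp [invSign, hc, hb]
  · have : ((v 1 + x * v 2) ^ 2 - 2 * (v 0 + x * v 1 + x ^ 2 / 2 * v 2) * v 2) / v 2 ^ 2 =
        (v 1 ^ 2 - 2 * v 0 * v 2) / v 2 ^ 2 := by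
      field_simp; ring
    simp [invSign, hc, this]

lemma quadraticChar_square (s : Fˣ) (hs : IsSquare s) : quadraticChar F s = 1 := by
  rw [quadraticChar_one_iff_isSquare s.ne_zero]
  obtain ⟨r, rfl⟩ := hs
  exact ⟨r, by simp⟩

lemma invSign_sAut {s : Fˣ} (hs : IsSquare s) (v : Fin 3 → F) :
    invSign α β ε (sAut s v) = invSign α β ε v := by
  rw [sAut_apply]
  have h := quadraticChar_square s hs
  by_cases hc : v 2 = 0
  · by_cases hb : v 1 = 0 <;> simp [invSign, hc, hb, h, -quadraticChar_apply]
  · have : ((s * v 1) ^ 2 - 2 * (s * v 0) * (s * v 2)) / (s * v 2) ^ 2 =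
        (v 1 ^ 2 - 2 * v 0 * v 2) / v 2 ^ 2 := by
      have := s.ne_zero
      field_simp
    simp [invSign, hc, this, h, -quadraticChar_apply]

/-- An odd `A`-invariant function is determined by its values at representatives of the orbits of
the group generated by `A` and `-1`. -/
lemma eq_of_odd_of_invariant (hF : Nat.card F % 4 = 3) {f g : (Fin 3 → F) → ℤ}
    (hf : ∀ v, f (-v) = -f v) (hg : ∀ v, g (-v) = -g v)
    (hfe : ∀ (x : F) v, f (eAut x v) = f v) (hge : ∀ (x : F) v, g (eAut x v) = g v)
    (hfs : ∀ s : Fˣ, IsSquare s → ∀ v, f (sAut s v) = f v)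
    (hgs : ∀ s : Fˣ, IsSquare s → ∀ v, g (sAut s v) = g v)
    (hc : ∀ t, f ![-t / 2, 0, 1] = g ![-t / 2, 0, 1]) (hb : f ![0, 1, 0] = g ![0, 1, 0])
    (ha : f ![1, 0, 0] = g ![1, 0, 0]) : f = g := by
  have h2 := two_ne_zero_of_odd (odd_card_of_card hF)
  -- As -1 is a non-square, each non-zero scalar is a square or minus a square; A handles the square
  -- and oddness the sign.
  have hscale : ∀ (x : F), x ≠ 0 → ∀ v, f v = g v → f (x • v) = g (x • v) := by
    intro x hx v hv
    have hsq : ∀ y : F, y ≠ 0 → quadraticChar F y = 1 → f (y • v) = g (y • v) := by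
      intro y hy h
      obtain ⟨r, hr⟩ := (quadraticChar_one_iff_isSquare hy).1 h
      have hr0 : r ≠ 0 := fun h => hy (by simp [hr, h])
      have hu : IsSquare (Units.mk0 r hr0 * Units.mk0 r hr0) := ⟨_, rfl⟩
      have e : y • v = sAut (Units.mk0 r hr0 * Units.mk0 r hr0) v := by
        rw [sAut_apply, hr]; simp
      rw [e, hfs _ hu, hgs _ hu, hv]
    rcases quadraticChar_dichotomy hx with h | h
    · exact hsq x hx h
    · have := hsq (-x) (neg_ne_zero.2 hx) (by rw [quadraticChar_neg_of_card hF, h, neg_neg])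
      rw [neg_smul, hf, hg] at this
      exact neg_injective this
  have hzero : ∀ f : (Fin 3 → F) → ℤ, (∀ v, f (-v) = -f v) → f 0 = 0 := by
    intro f hf
    have := hf 0
    rw [neg_zero] at this
    omega
  funext v
  by_cases h3 : v 2 = 0
  · by_cases h1 : v 1 = 0
    · by_cases h0 : v 0 = 0
      · have : v = 0 := by ext i; fin_cases i <;> assumption
        rw [this, hzero f hf, hzero g hg]
      · have : v = v 0 • ![1, 0, 0] := by ext i; fin_cases i <;> simp [h3, h1]
        rw [this]
        exact hscale _ h0 _ ha
    · have : v = v 1 • eAut (v 0 / v 1) ![0, 1, 0] := by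
        rw [eAut_apply]
        ext i; fin_cases i <;> simp [h3]
        field_simp
      rw [this]
      exact hscale _ h1 _ (by rw [hfe, hge, hb])
  -- After scaling to c = 1, the element E(b/c) moves the representative with the same invariant t
  -- to the given vector.
  · have : v = v 2 • eAut (v 1 / v 2) ![-((v 1 ^ 2 - 2 * v 0 * v 2) / v 2 ^ 2) / 2, 0, 1] := by
      rw [eAut_apply]
      ext i; fin_cases i <;> simp <;> field_simp
      ring
    rw [this]
    exact hscale _ h3 _ (by rw [hfe, hge, hc])

lemma invSign_rep_c (h2 : (2 : F) ≠ 0) (t : F) : invSign α β ε ![-t / 2, 0, 1] = ε t := by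
  have : -(2 * (-t / 2)) = t := by field_simp
  simp [invSign, this]

lemma invSign_rep_b : invSign α β ε ![0, 1, 0] = β := by
  simp [invSign]

lemma invSign_rep_a : invSign α β ε ![1, 0, 0] = α := by
  simp [invSign]

lemma invSet_injective (hF : Nat.card F % 4 = 3) {α' β' : ℤˣ} {ε' : F → ℤˣ}
    (h : invSet α β ε = invSet α' β' ε') : α = α' ∧ β = β' ∧ ε = ε' := by
  have h2 := two_ne_zero_of_odd (odd_card_of_card hF)
  have h1 : ∀ v, invSign α β ε v = invSign α' β' ε' v := fun v => by
    rw [← setSign_invSet hF, h, setSign_invSet hF]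
  refine ⟨Units.ext ?_, Units.ext ?_, funext fun t => Units.ext ?_⟩
  · rw [← invSign_rep_a (α := α) (β := β) (ε := ε), h1, invSign_rep_a]
  · rw [← invSign_rep_b (α := α) (β := β) (ε := ε), h1, invSign_rep_b]
  · rw [← invSign_rep_c (α := α) (β := β) (ε := ε) h2, h1, invSign_rep_c h2]

lemma image_invSet (hF : Nat.card F % 4 = 3) {g : AutV F} (hg : g ∈ groupA F) :
    g '' invSet α β ε = invSet α β ε := by
  have h2 := two_ne_zero_of_odd (odd_card_of_card hF)
  obtain ⟨s, x, hs, rfl⟩ := (mem_groupA h2).1 hg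
  have h : ∀ v, invSign α β ε ((sAut s * eAut x : AutV F) v) = invSign α β ε v := fun v => by
    rw [LinearEquiv.mul_apply, invSign_sAut hs, invSign_eAut h2]
  ext v
  constructor
  · rintro ⟨w, hw, rfl⟩
    exact (h w).trans hw
  · intro hv
    refine ⟨(sAut s * eAut x : AutV F).symm v, ?_, LinearEquiv.apply_symm_apply _ _⟩
    change invSign α β ε _ = 1
    rw [← h, LinearEquiv.apply_symm_apply]
    exact hv

/-- Every `A`-invariant skew set is one of the sets `invSet α β ε`. -/
lemma exists_eq_invSet (hF : Nat.card F % 4 = 3) {D : Set (Fin 3 → F)} (hD : IsSkew D)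
    (hA : ∀ g ∈ groupA F, g '' D = D) : ∃ α β ε, D = invSet α β ε := by
  have h2 := two_ne_zero_of_odd (odd_card_of_card hF)
  have hunit : ∀ v : Fin 3 → F, v ≠ 0 → ∃ u : ℤˣ, setSign D v = u := by
    intro v hv
    have h := hD.setSign_sq hv
    exact ⟨⟨setSign D v, setSign D v, h, h⟩, rfl⟩
  have hne : ∀ (v : Fin 3 → F) (i : Fin 3), v i ≠ 0 → v ≠ 0 := fun v i hi h => hi (by simp [h])
  obtain ⟨α, hα⟩ := hunit ![1, 0, 0] (hne _ 0 (by simp))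
  obtain ⟨β, hβ⟩ := hunit ![0, 1, 0] (hne _ 1 (by simp))
  choose ε hε using fun t : F => hunit ![-t / 2, 0, 1] (hne _ 2 (by simp))
  refine ⟨α, β, ε, ?_⟩
  have key : setSign D = invSign α β ε := by
    apply eq_of_odd_of_invariant hF (setSign_neg D) (invSign_neg hF)
    · exact fun x v => setSign_image (hA _ ((mem_groupA h2).2
        ⟨1, x, IsSquare.one, by rw [sAut_one, one_mul]⟩)) v
    · exact fun x v => invSign_eAut h2 x v
    · exact fun s hs v => setSign_image (hA _ ((mem_groupA h2).2
        ⟨s, 0, hs, by rw [eAut_zero, mul_one]⟩)) v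
    · exact fun s hs v => invSign_sAut hs v
    · exact fun t => by rw [hε, invSign_rep_c h2]
    · rw [hβ, invSign_rep_b]
    · rw [hα, invSign_rep_a]
  ext v
  rw [hD.mem_iff_setSign, key]
  rfl

end InvariantSets

/-! ### The Fourier transform of the sign functions -/

section Fourier

variable {F : Type*} [Field F] [Fintype F] [DecidableEq F]

/-- The Fourier transform of an integer-valued function on `V`. -/
noncomputable def hat {F : Type*} [Field F] [Fintype F] (ψ : AddChar F ℂ)
    (f : (Fin 3 → F) → ℤ) (y : Fin 3 → F) : ℂ :=
  ∑ v, (f v : ℂ) * ψ (y ⬝ᵥ v)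

variable {ψ : AddChar F ℂ}

lemma sum_char_dotProduct (hψ : ψ.IsPrimitive) (h : Fin 3 → F) :
    ∑ y : Fin 3 → F, ψ (y ⬝ᵥ h) = if h = 0 then (Nat.card (Fin 3 → F) : ℂ) else 0 := by
  split_ifs with h0
  · simp [h0]
  · obtain ⟨i, hi⟩ := Function.ne_iff.1 h0
    let φ : AddChar (Fin 3 → F) ℂ :=
      { toFun := fun y => ψ (y ⬝ᵥ h)
        map_zero_eq_one' := by simp
        map_add_eq_mul' := fun x y => by rw [add_dotProduct, AddChar.map_add_eq_mul] }
    have hφ : φ ≠ 1 := by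
      obtain ⟨x, hx⟩ := AddChar.ne_one_iff.1 (hψ hi)
      refine AddChar.ne_one_iff.2 ⟨Pi.single i x, ?_⟩
      change ψ (Pi.single i x ⬝ᵥ h) ≠ 1
      rw [single_dotProduct, mul_comm]
      exact hx
    exact AddChar.sum_eq_zero_of_ne_one hφ

/-- For odd f the coefficients at y and -y are opposite, so the square is minus their product, and
that product is the transform of the autocorrelation. -/
lemma hat_sq {F : Type*} [Field F] [Fintype F] {ψ : AddChar F ℂ} (f : (Fin 3 → F) → ℤ)
    (hf : ∀ v, f (-v) = -f v) (y : Fin 3 → F) :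
    hat ψ f y ^ 2 = -∑ h, ((∑ x, f x * f (x + h) : ℤ) : ℂ) * ψ (y ⬝ᵥ h) := by
  have h1 : hat ψ f y = -∑ v, (f v : ℂ) * ψ (y ⬝ᵥ (-v)) := by
    rw [hat, ← Finset.sum_neg_distrib]
    refine Fintype.sum_equiv (Equiv.neg _) _ _ fun v => ?_
    simp [hf]
  rw [sq]
  nth_rw 1 [h1]
  rw [hat, neg_mul, Finset.sum_mul_sum]
  congr 1
  have h3 : ∀ h, ((∑ x, f x * f (x + h) : ℤ) : ℂ) * ψ (y ⬝ᵥ h) =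
      ∑ x, (f x : ℂ) * f (x + h) * ψ (y ⬝ᵥ h) := fun h => by
    push_cast
    rw [Finset.sum_mul]
  simp_rw [h3]
  conv_rhs => rw [Finset.sum_comm]
  refine Finset.sum_congr rfl fun x _ => ?_
  refine Fintype.sum_equiv (Equiv.addLeft (-x)) _ _ fun z => ?_
  simp only [Equiv.coe_addLeft, add_neg_cancel_left, dotProduct_add, AddChar.map_add_eq_mul]
  ring

/-- An odd sign function is perfectly autocorrelated if and only if the squares of its non-trivial
Fourier coefficients are equal to `-|V|`. -/
lemma autocorrelation_iff_hat (hψ : ψ.IsPrimitive) {f : (Fin 3 → F) → ℤ}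
    (hf : ∀ v, f (-v) = -f v) (hf2 : ∑ x, f x * f x = Nat.card (Fin 3 → F) - 1) :
    (∀ h ≠ 0, ∑ x, f x * f (x + h) = -1) ↔
      ∀ y ≠ 0, hat ψ f y ^ 2 = -(Nat.card (Fin 3 → F) : ℂ) := by
  have hcomm : ∀ y h : Fin 3 → F, ψ (y ⬝ᵥ h) = ψ (h ⬝ᵥ y) := fun y h => by rw [dotProduct_comm]
  set N : ℂ := (Nat.card (Fin 3 → F) : ℂ) with hN
  constructor
  · intro h y hy
    rw [hat_sq f hf]
    have h1 : ∀ h : Fin 3 → F, ((∑ x, f x * f (x + h) : ℤ) : ℂ) * ψ (y ⬝ᵥ h) =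
        (if h = 0 then N else 0) - ψ (h ⬝ᵥ y) := by
      intro z
      split_ifs with hz
      · subst hz
        simp only [add_zero, hf2]
        push_cast
        simp [hN]
      · rw [h z hz, hcomm]
        push_cast
        ring
    simp only [h1, Finset.sum_sub_distrib, sum_char_dotProduct hψ, hy, if_false]
    simp
  · intro h z hz
    have h0 : hat ψ f 0 = 0 := by
      have h3 : ∑ v, f v = 0 := by
        have : ∑ v, f v = ∑ v, f (-v) :=
          Fintype.sum_equiv (Equiv.neg _) _ _ (fun y => by simp)
        simp_rw [hf, Finset.sum_neg_distrib] at this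
        omega
      simp only [hat, zero_dotProduct, AddChar.map_zero_eq_one, mul_one]
      exact_mod_cast h3
    -- Fourier inversion at z; the constant value -N of the squares fails only at y = 0, where the
    -- coefficient vanishes by oddness.
    have h4 : ∑ y, hat ψ f y ^ 2 * ψ (y ⬝ᵥ (-z)) = N := by
      have : ∀ y, hat ψ f y ^ 2 * ψ (y ⬝ᵥ (-z)) = (if y = 0 then N else 0) - N * ψ (y ⬝ᵥ (-z)) := by
        intro y
        split_ifs with hy
        · subst hy
          simp [h0]
        · rw [h y hy]; ring
      simp only [this, Finset.sum_sub_distrib, ← Finset.mul_sum, sum_char_dotProduct hψ,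
        neg_eq_zero, hz, if_false]
      simp
    simp_rw [hat_sq f hf, neg_mul, Finset.sum_mul] at h4
    rw [Finset.sum_neg_distrib, Finset.sum_comm] at h4
    have h5 : ∀ h : Fin 3 → F, ∑ y, ((∑ x, f x * f (x + h) : ℤ) : ℂ) * ψ (y ⬝ᵥ h) *
        ψ (y ⬝ᵥ (-z)) = if h = z then ((∑ x, f x * f (x + h) : ℤ) : ℂ) * N else 0 := by
      intro h
      simp_rw [mul_assoc, ← AddChar.map_add_eq_mul, ← dotProduct_add, ← Finset.mul_sum,
        sum_char_dotProduct hψ, ← sub_eq_add_neg, sub_eq_zero]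
      split_ifs <;> simp [hN]
    simp only [h5, Finset.sum_ite_eq', Finset.mem_univ, if_true] at h4
    have hN0 : N ≠ 0 := by
      rw [hN]
      exact_mod_cast Nat.card_pos.ne'
    have h6 : ((∑ x, f x * f (x + z) : ℤ) : ℂ) = -1 := by
      apply mul_right_cancel₀ hN0
      linear_combination -h4
    exact_mod_cast h6

/-- The quadratic character with complex values. -/
noncomputable def quadC (F : Type*) [Field F] [Fintype F] [DecidableEq F] : MulChar F ℂ :=
  (quadraticChar F).ringHomComp (Int.castRingHom ℂ)

lemma quadC_apply (x : F) : quadC F x = (quadraticChar F x : ℂ) := rfl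

lemma quadC_ne_one (hF : ringChar F ≠ 2) : quadC F ≠ 1 :=
  (MulChar.ringHomComp_ne_one_iff Int.cast_injective).2 (quadraticChar_ne_one hF)

lemma gaussSum_quadC_sq (hF : Nat.card F % 4 = 3) (hψ : ψ.IsPrimitive) :
    gaussSum (quadC F) ψ ^ 2 = -(Nat.card F : ℂ) := by
  rw [gaussSum_sq (quadC_ne_one (ringChar_ne_two_of_card hF))
    ((quadraticChar_isQuadratic F).comp _) hψ, quadC_apply, quadraticChar_neg_of_card hF]
  simp

lemma sum_quadraticChar_mul_char (hF : ringChar F ≠ 2) (z : F) :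
    ∑ c, (quadraticChar F c : ℂ) * ψ (c * z) = gaussSum (quadC F) ψ * quadraticChar F z := by
  by_cases hz : z = 0
  · subst hz
    have := quadraticChar_sum_zero hF
    simp only [mul_zero, AddChar.map_zero_eq_one, mul_one, quadraticChar_zero, Int.cast_zero]
    exact_mod_cast this
  · have h1 := gaussSum_mulShift (quadC F) ψ (Units.mk0 z hz)
    have h3 : (quadraticChar F z : ℂ) ^ 2 = 1 := by
      exact_mod_cast quadraticChar_sq_one hz
    rw [← h1, Units.val_mk0, quadC_apply]
    simp only [gaussSum, AddChar.mulShift_apply, quadC_apply, mul_comm z]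
    linear_combination (-∑ c, (quadraticChar F c : ℂ) * ψ (c * z)) * h3

lemma sum_fin_three {F : Type*} [Fintype F] {M : Type*} [AddCommMonoid M] (g : (Fin 3 → F) → M) :
    ∑ v, g v = ∑ c, ∑ b, ∑ a, g ![a, b, c] := by
  let e : F × F × F ≃ (Fin 3 → F) :=
    { toFun := fun x => ![x.2.2, x.2.1, x.1]
      invFun := fun v => (v 2, v 1, v 0)
      left_inv := fun x => rfl
      right_inv := fun v => by ext i; fin_cases i <;> rfl }
  rw [← Fintype.sum_equiv e (fun x => g ![x.2.2, x.2.1, x.1]) g (fun x => rfl),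
    Fintype.sum_prod_type]
  simp_rw [Fintype.sum_prod_type]

/-- The integer `J` such that the Fourier coefficient of `invSign` is `J` times a Gauss sum. -/
noncomputable def hatCoeff (α β : ℤˣ) (ε : F → ℤˣ) (u v w : F) : ℤ :=
  ∑ t, (ε t : ℤ) * ∑ y, quadraticChar F (u * ((y ^ 2 - t) / 2) + v * y + w) +
    (if u = 0 then (Nat.card F : ℤ) * ((β : ℤ) * quadraticChar F v) else 0) +
    (α : ℤ) * quadraticChar F u

variable {α β : ℤˣ} {ε : F → ℤˣ}

/-- For c ≠ 0 substitute b = cy and a = c(y² - t)/2: then t is the invariant of (a,b,c) and c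
factors out of the phase. Summing χ(c)ψ(cz) over c leaves the Gauss sum times χ(z). The plane c = 0
supplies the terms with β and α. -/
lemma hat_invSign (hF : Nat.card F % 4 = 3) (hψ : ψ.IsPrimitive) (u v w : F) :
    hat ψ (invSign α β ε) ![u, v, w] = gaussSum (quadC F) ψ * hatCoeff α β ε u v w := by
  have hF2 := ringChar_ne_two_of_card hF
  have h2 : (2 : F) ≠ 0 := two_ne_zero_of_odd (odd_card_of_card hF)
  rw [hat, sum_fin_three]
  -- the planes with non-zero last coordinate
  have hc : ∀ c : F, c ≠ 0 → ∑ b, ∑ a, (invSign α β ε ![a, b, c] : ℂ) *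
      ψ (![u, v, w] ⬝ᵥ ![a, b, c]) = ∑ t, ∑ y, (ε t : ℂ) * ((quadraticChar F c : ℂ) *
        ψ (c * (u * ((y ^ 2 - t) / 2) + v * y + w))) := by
    intro c hc
    rw [Finset.sum_comm (s := Finset.univ (α := F)) (t := Finset.univ (α := F))
      (f := fun t y => (ε t : ℂ) * ((quadraticChar F c : ℂ) *
        ψ (c * (u * ((y ^ 2 - t) / 2) + v * y + w))))]
    symm
    refine Fintype.sum_equiv (Equiv.mulLeft₀ c hc) _ _ fun y => ?_
    let e : F ≃ F :=
      { toFun := fun t => c * ((y ^ 2 - t) / 2)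
        invFun := fun a => y ^ 2 - 2 * a / c
        left_inv := fun t => by field_simp; ring
        right_inv := fun a => by field_simp; ring }
    refine Fintype.sum_equiv e _ _ fun t => ?_
    have h3 : ((c * y) ^ 2 - 2 * (c * ((y ^ 2 - t) / 2)) * c) / c ^ 2 = t := by
      field_simp; ring
    have h4 : c * (u * ((y ^ 2 - t) / 2) + v * y + w) =
        u * (c * ((y ^ 2 - t) / 2)) + v * (c * y) + w * c := by ring
    simp only [e, invSign, dotProduct, Fin.sum_univ_three, Equiv.coe_fn_mk, Equiv.mulLeft₀_apply]
    simp [hc, h3, h4]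
    ring
  have hc0 : ∑ b, ∑ a, (invSign α β ε ![a, b, 0] : ℂ) * ψ (![u, v, w] ⬝ᵥ ![a, b, 0]) =
      gaussSum (quadC F) ψ * ((if u = 0 then Nat.card F * ((β : ℂ) * quadraticChar F v) else 0) +
        α * quadraticChar F u) := by
    have h3 : ∀ b a, (invSign α β ε ![a, b, 0] : ℂ) * ψ (![u, v, w] ⬝ᵥ ![a, b, 0]) =
        (β : ℂ) * (quadraticChar F b * ψ (b * v)) * ψ (a * u) +
        if b = 0 then (α : ℂ) * (quadraticChar F a * ψ (a * u)) else 0 := by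
      intro b a
      simp only [invSign, dotProduct, Fin.sum_univ_three]
      by_cases hb : b = 0
      · simp [hb, mul_comm a, mul_assoc, -quadraticChar_apply, quadraticChar_zero]
      · simp [hb, mul_comm a, mul_comm b, mul_assoc, AddChar.map_add_eq_mul, -quadraticChar_apply]
        exact Or.inl (mul_comm _ _)
    simp_rw [h3, Finset.sum_add_distrib]
    have h4 : ∑ a, ψ (a * u) = if u = 0 then (Nat.card F : ℂ) else 0 := by
      rw [AddChar.sum_mulShift u hψ]
      simp
    have h5 : ∑ b : F, ∑ a : F, (if b = 0 then (α : ℂ) * (quadraticChar F a * ψ (a * u)) else 0) =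
        α * (gaussSum (quadC F) ψ * quadraticChar F u) := by
      rw [Finset.sum_eq_single 0 (fun b _ hb => by simp [hb]) (by simp)]
      simp only [if_true, ← Finset.mul_sum, sum_quadraticChar_mul_char hF2]
    rw [h5]
    simp_rw [← Finset.mul_sum, h4, ← Finset.sum_mul, ← Finset.mul_sum,
      sum_quadraticChar_mul_char hF2]
    split_ifs <;> ring
  -- Since χ(0) = 0, the second sum may include c = 0 at no cost.
  have hsum : ∑ c, ∑ b, ∑ a, (invSign α β ε ![a, b, c] : ℂ) * ψ (![u, v, w] ⬝ᵥ ![a, b, c]) =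
      (∑ b, ∑ a, (invSign α β ε ![a, b, 0] : ℂ) * ψ (![u, v, w] ⬝ᵥ ![a, b, 0])) +
      ∑ c, ∑ t, ∑ y, (ε t : ℂ) * ((quadraticChar F c : ℂ) *
        ψ (c * (u * ((y ^ 2 - t) / 2) + v * y + w))) := by
    rw [← Finset.add_sum_erase _ _ (Finset.mem_univ (0 : F)),
      ← Finset.add_sum_erase _ (fun c => ∑ t, ∑ y, (ε t : ℂ) * ((quadraticChar F c : ℂ) *
        ψ (c * (u * ((y ^ 2 - t) / 2) + v * y + w)))) (Finset.mem_univ (0 : F))]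
    congr 1
    simp only [quadraticChar_zero, Int.cast_zero, zero_mul, mul_zero, Finset.sum_const_zero,
      zero_add]
    exact Finset.sum_congr rfl fun c hc' => hc c (Finset.ne_of_mem_erase hc')
  rw [hsum, hc0]
  have hmain : ∑ c, ∑ t, ∑ y, (ε t : ℂ) * ((quadraticChar F c : ℂ) *
        ψ (c * (u * ((y ^ 2 - t) / 2) + v * y + w))) = gaussSum (quadC F) ψ *
      ∑ t, (ε t : ℂ) * ∑ y, (quadraticChar F (u * ((y ^ 2 - t) / 2) + v * y + w) : ℂ) := by
    rw [Finset.sum_comm, Finset.mul_sum]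
    refine Finset.sum_congr rfl fun t _ => ?_
    rw [Finset.sum_comm]
    simp_rw [← Finset.mul_sum, sum_quadraticChar_mul_char hF2, ← Finset.mul_sum]
    ring
  rw [hmain, hatCoeff]
  split_ifs <;> push_cast <;> ring

end Fourier

/-! ### The invariant skew Hadamard difference sets and their number -/

section Count

variable {F : Type*} [Field F] [Fintype F] [DecidableEq F]

/-- An element x has χ(x) + 1 square roots. -/
lemma sum_comp_sq (hF : ringChar F ≠ 2) (g : F → ℤ) :
    ∑ y, g (y ^ 2) = ∑ x, (quadraticChar F x + 1) * g x := by
  rw [← Finset.sum_fiberwise Finset.univ (fun y : F => y ^ 2) (fun y => g (y ^ 2))]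
  refine Finset.sum_congr rfl fun x _ => ?_
  rw [← quadraticChar_card_sqrts hF x, Finset.sum_congr rfl
    (g := fun _ => g x) (fun y hy => by rw [(Finset.mem_filter.1 hy).2]), Finset.sum_const,
    nsmul_eq_mul]
  congr 3
  ext y
  simp

/-- Scaling by s turns the sum into χ(-1) times the Jacobi sum of χ and its inverse, which equals
-χ(-1). -/
lemma sum_quadraticChar_mul_sub (hF : ringChar F ≠ 2) {s : F} (hs : s ≠ 0) :
    ∑ x, quadraticChar F x * quadraticChar F (x - s) = -1 := by
  have h1 := jacobiSum_nontrivial_inv (quadraticChar_ne_one hF)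
  rw [(quadraticChar_isQuadratic F).inv, jacobiSum] at h1
  have h3 : ∑ x, quadraticChar F x * quadraticChar F (x - s) =
      ∑ x, quadraticChar F (-1) * (quadraticChar F x * quadraticChar F (1 - x)) := by
    symm
    refine Fintype.sum_equiv (Equiv.mulLeft₀ s hs) _ _ fun x => ?_
    have h4 : s * x - s = s * (-1 * (1 - x)) := by ring
    rw [Equiv.mulLeft₀_apply, h4, map_mul, map_mul, map_mul]
    linear_combination (-quadraticChar F (-1) * quadraticChar F x * quadraticChar F (1 - x)) *
      quadraticChar_sq_one hs
  rw [h3, ← Finset.mul_sum, h1]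
  linear_combination -quadraticChar_sq_one (neg_ne_zero.2 (one_ne_zero (α := F)))

lemma sum_quadraticChar_sq_sub (hF : ringChar F ≠ 2) (s : F) :
    ∑ y, quadraticChar F (y ^ 2 - s) = (if s = 0 then (Nat.card F : ℤ) else 0) - 1 := by
  rw [sum_comp_sq hF fun x => quadraticChar F (x - s)]
  simp_rw [add_mul, one_mul, Finset.sum_add_distrib]
  have h1 : ∑ x, quadraticChar F (x - s) = 0 := by
    rw [← quadraticChar_sum_zero hF]
    exact Fintype.sum_equiv (Equiv.subRight s) _ _ fun _ => rfl
  rw [h1, add_zero]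
  split_ifs with hs
  · subst hs
    have : ∀ x : F, quadraticChar F x * quadraticChar F (x - 0) = 1 - if x = 0 then 1 else 0 := by
      intro x
      split_ifs with hx
      · simp [hx]
      · rw [sub_zero, ← sq, quadraticChar_sq_one hx, sub_zero]
    simp only [this, Finset.sum_sub_distrib]
    simp
  · rw [sum_quadraticChar_mul_sub hF hs, zero_sub]

/-! ### Evaluation of the Fourier coefficients -/

variable {α β : ℤˣ} {ε : F → ℤˣ}

/-- Completing the square reduces the inner sum to χ(2u) ∑ χ(y² - s). The latter sum is -1, except
that it is q - 1 for the single t with s = 0, which singles out one value of ε. -/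
lemma hatCoeff_of_ne_zero (hF : Nat.card F % 4 = 3) {u : F} (hu : u ≠ 0) (v w : F) :
    hatCoeff α β ε u v w = quadraticChar F u * (quadraticChar F 2 *
      (Nat.card F * ε (2 * w / u - v ^ 2 / u ^ 2) - ∑ t, (ε t : ℤ)) + α) := by
  have hF2 := ringChar_ne_two_of_card hF
  have h2 : (2 : F) ≠ 0 := two_ne_zero_of_odd (odd_card_of_card hF)
  have h1 : ∀ t, ∑ y, quadraticChar F (u * ((y ^ 2 - t) / 2) + v * y + w) =
      quadraticChar F u * quadraticChar F 2 *
        ((if t = 2 * w / u - v ^ 2 / u ^ 2 then (Nat.card F : ℤ) else 0) - 1) := by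
    intro t
    have h3 := sum_quadraticChar_sq_sub hF2 (t - (2 * w / u - v ^ 2 / u ^ 2))
    simp only [sub_eq_zero] at h3
    rw [← h3, Finset.mul_sum]
    refine Fintype.sum_equiv (Equiv.addRight (v / u)) _ _ fun y => ?_
    have h4 : u * ((y ^ 2 - t) / 2) + v * y + w =
        u * 2 * (2⁻¹ ^ 2 * ((y + v / u) ^ 2 - (t - (2 * w / u - v ^ 2 / u ^ 2)))) := by
      field_simp; ring
    rw [h4, map_mul, map_mul, map_mul, quadraticChar_sq_one' (inv_ne_zero h2), one_mul]
    rfl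
  unfold hatCoeff
  simp_rw [h1, if_neg hu, add_zero]
  have h5 : ∀ t, (ε t : ℤ) * (quadraticChar F u * quadraticChar F 2 *
        ((if t = 2 * w / u - v ^ 2 / u ^ 2 then (Nat.card F : ℤ) else 0) - 1)) =
      quadraticChar F u * quadraticChar F 2 *
        ((if t = 2 * w / u - v ^ 2 / u ^ 2 then (Nat.card F : ℤ) * ε t else 0) - ε t) := by
    intro t
    split_ifs <;> ring
  simp_rw [h5, ← Finset.mul_sum, Finset.sum_sub_distrib, Finset.sum_ite_eq', Finset.mem_univ,
    if_true]
  ring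

lemma hatCoeff_zero_of_ne_zero (hF : Nat.card F % 4 = 3) {v : F} (hv : v ≠ 0) (w : F) :
    hatCoeff α β ε 0 v w = Nat.card F * (β * quadraticChar F v) := by
  have hF2 := ringChar_ne_two_of_card hF
  have h1 : ∀ t : F, ∑ y, quadraticChar F (0 * ((y ^ 2 - t) / 2) + v * y + w) = 0 := by
    intro t
    rw [← quadraticChar_sum_zero hF2]
    refine Fintype.sum_equiv ((Equiv.mulLeft₀ v hv).trans (Equiv.addRight w)) _ _ fun y => ?_
    simp
  unfold hatCoeff
  simp_rw [h1, quadraticChar_zero]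
  simp

lemma hatCoeff_zero_zero (w : F) :
    hatCoeff α β ε 0 0 w = Nat.card F * quadraticChar F w * ∑ t, (ε t : ℤ) := by
  unfold hatCoeff
  simp only [zero_mul, zero_add, Finset.sum_const, quadraticChar_zero, mul_zero, ite_self,
    add_zero, Finset.card_univ, ← Nat.card_eq_fintype_card, nsmul_eq_mul, ← Finset.sum_mul]
  ring

lemma sq_intUnit (u : ℤˣ) : (u : ℤ) ^ 2 = 1 := by
  rcases Int.units_eq_one_or u with rfl | rfl <;> simp

/-- Put K = χ(2)α - ∑ ε. For u ≠ 0 the condition reads (qε(t) + K)² = q², so K = 0 or K = -2qε(t)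
for all t. The second case makes ε constant and yields χ(2)α = -qε, which is absurd as q > 1. The
sign β enters only through its square. -/
lemma hatCoeff_sq_iff (hF : Nat.card F % 4 = 3) :
    (∀ u v w : F, ¬(u = 0 ∧ v = 0 ∧ w = 0) → hatCoeff α β ε u v w ^ 2 = (Nat.card F : ℤ) ^ 2) ↔
      ∑ t, (ε t : ℤ) = quadraticChar F 2 * α := by
  have h2 : (2 : F) ≠ 0 := two_ne_zero_of_odd (odd_card_of_card hF)
  have hη := quadraticChar_sq_one h2
  have hα := sq_intUnit α
  constructor
  · intro h
    have h1 : ∀ t, ((Nat.card F : ℤ) * ε t + (quadraticChar F 2 * α - ∑ t, (ε t : ℤ))) ^ 2 =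
        (Nat.card F : ℤ) ^ 2 := by
      intro t
      -- This point of the dual space picks out the value of ε at t.
      have h3 := h 1 0 (t / 2) (by simp)
      rw [hatCoeff_of_ne_zero hF one_ne_zero] at h3
      have h4 : 2 * (t / 2) / 1 - 0 ^ 2 / 1 ^ 2 = t := by field_simp; ring
      rw [h4, map_one] at h3
      rw [← h3]
      generalize ∑ t, (ε t : ℤ) = s
      linear_combination (-((Nat.card F : ℤ) * ε t - s) ^ 2) * hη + α ^ 2 * hη
    by_contra hne
    set K := quadraticChar F 2 * α - ∑ t, (ε t : ℤ) with hK
    have hK0 : K ≠ 0 := fun h0 => hne (by linarith)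
    have h5 : ∀ t, K = -2 * Nat.card F * ε t := by
      intro t
      apply mul_left_cancel₀ hK0
      linear_combination h1 t - (Nat.card F : ℤ) ^ 2 * sq_intUnit (ε t)
    have hq : (0 : ℤ) < Nat.card F := by exact_mod_cast Nat.card_pos
    have h6 : ∀ t, (ε t : ℤ) = ε 0 := by
      intro t
      have h7 := (h5 t).symm.trans (h5 0)
      exact mul_left_cancel₀ (by positivity : (-2 * (Nat.card F : ℤ)) ≠ 0) h7
    have h7 : ∑ t, (ε t : ℤ) = Nat.card F * ε 0 := by
      simp_rw [h6]
      simp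
    have h8 : quadraticChar F 2 * α = -(Nat.card F * ε 0) := by
      have := h5 0
      rw [hK, h7] at this
      linear_combination this
    have h9 : (1 : ℤ) = (Nat.card F : ℤ) ^ 2 := by
      have h10 := congrArg (· ^ 2) h8
      simp only [mul_pow, neg_sq, hη, hα, sq_intUnit, mul_one] at h10
      exact h10
    have h11 : (1 : ℤ) < Nat.card F := by exact_mod_cast Finite.one_lt_card
    nlinarith
  · intro h u v w hne
    by_cases hu : u = 0
    · subst hu
      by_cases hv : v = 0
      · subst hv
        have hw : w ≠ 0 := fun h0 => hne ⟨rfl, rfl, h0⟩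
        rw [hatCoeff_zero_zero, h]
        simp only [mul_pow, quadraticChar_sq_one hw, hη, hα, mul_one]
      · rw [hatCoeff_zero_of_ne_zero hF hv]
        simp only [mul_pow, quadraticChar_sq_one hv, sq_intUnit, mul_one]
    · rw [hatCoeff_of_ne_zero hF hu, h]
      have h3 : ∀ e : ℤ, quadraticChar F 2 * (Nat.card F * e - quadraticChar F 2 * α) + α =
          quadraticChar F 2 * (Nat.card F * e) := fun e => by
        linear_combination (-(α : ℤ)) * hη
      rw [h3]
      simp only [mul_pow, quadraticChar_sq_one hu, hη, sq_intUnit, mul_one, one_mul]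

lemma card_fin_three {F : Type*} [Finite F] : Nat.card (Fin 3 → F) = Nat.card F ^ 3 := by
  rw [Nat.card_fun, Nat.card_fin]

/-- The invariant skew set `invSet α β ε` is a difference set exactly if the sum of the signs `ε`
is as prescribed by the sign `α`. -/
lemma isSkewHadamard_invSet_iff (hF : Nat.card F % 4 = 3) :
    IsSkewHadamard (invSet α β ε) ↔ ∑ t, (ε t : ℤ) = quadraticChar F 2 * α := by
  have hs : IsSkew (invSet α β ε) := isSkew_invSet hF
  have hV : Nat.card (Fin 3 → F) % 4 = 3 := by
    rw [card_fin_three, Nat.pow_mod, hF]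
  obtain ⟨ψ, hψ'⟩ := AddChar.exists_apply_ne_zero.2 (one_ne_zero (α := F))
  have hψ : ψ.IsPrimitive := AddChar.IsPrimitive.of_ne_one (AddChar.ne_one_iff.2 ⟨1, hψ'⟩)
  have h1 : IsSkewHadamard (invSet α β ε) ↔
      ∃ v k l, IsDifferenceSet (invSet α β ε) v k l := ⟨fun h => h.1, fun h => ⟨h, hs⟩⟩
  have h3 : setSign (invSet α β ε) = invSign α β ε := funext (setSign_invSet hF)
  rw [h1, hs.isDifferenceSet_iff hV, h3, autocorrelation_iff_hat hψ (invSign_neg hF)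
    (by rw [← h3]; exact hs.sum_setSign_mul_self), ← hatCoeff_sq_iff (β := β) hF]
  have h4 : ∀ u v w : F, hat ψ (invSign α β ε) ![u, v, w] ^ 2 = -(Nat.card (Fin 3 → F) : ℂ) ↔
      hatCoeff α β ε u v w ^ 2 = (Nat.card F : ℤ) ^ 2 := by
    intro u v w
    rw [hat_invSign hF hψ, mul_pow, gaussSum_quadC_sq hF hψ, card_fin_three]
    have hq : (Nat.card F : ℂ) ≠ 0 := by exact_mod_cast Nat.card_pos.ne'
    have h5 : -(Nat.card F : ℂ) * (hatCoeff α β ε u v w : ℂ) ^ 2 =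
        -((Nat.card F ^ 3 : ℕ) : ℂ) ↔
        (hatCoeff α β ε u v w : ℂ) ^ 2 = (Nat.card F : ℂ) ^ 2 := by
      push_cast
      constructor
      · intro h
        apply mul_left_cancel₀ hq
        linear_combination -h
      · intro h
        rw [h]; ring
    rw [h5]
    exact_mod_cast Iff.rfl
  constructor
  · intro h u v w hne
    refine (h4 u v w).1 (h _ fun h0 => hne ⟨congrFun h0 0, congrFun h0 1, congrFun h0 2⟩)
  · intro h y hy
    have hy' : y = ![y 0, y 1, y 2] := by ext i; fin_cases i <;> rfl
    rw [hy', h4]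
    exact h _ _ _ fun ⟨h0, h1, h2⟩ => hy (by ext i; fin_cases i <;> assumption)

/-- The number of sign functions on `F` with sum `±1`. -/
lemma card_signs_sum_eq {X : Type*} [Fintype X] [DecidableEq X] (hX : Odd (Fintype.card X))
    (δ : ℤˣ) : Nat.card {ε : X → ℤˣ // ∑ t, (ε t : ℤ) = δ} =
      (Fintype.card X).choose ((Fintype.card X + 1) / 2) := by
  obtain ⟨r, hr⟩ := hX
  -- With k values +1 the sum is 2k - (2r + 1), which is 1 or -1 for these k; both sizes give the
  -- same binomial coefficient.
  set k : ℕ := if δ = 1 then r + 1 else r with hk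
  have hsum : ∀ s : Finset X, ∑ t, ((if t ∈ s then (1 : ℤˣ) else -1 : ℤˣ) : ℤ) =
      2 * (s.card : ℤ) - Fintype.card X := by
    intro s
    have : ∀ t, ((if t ∈ s then (1 : ℤˣ) else -1 : ℤˣ) : ℤ) = 2 * (if t ∈ s then 1 else 0) - 1 := by
      intro t
      split_ifs <;> simp
    simp_rw [this, Finset.sum_sub_distrib, ← Finset.mul_sum]
    simp
  let e : {ε : X → ℤˣ // ∑ t, (ε t : ℤ) = δ} ≃ (Finset.univ : Finset X).powersetCard k :=
    { toFun := fun ε => ⟨Finset.univ.filter (fun t => ε.1 t = 1), by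
        rw [Finset.mem_powersetCard]
        refine ⟨Finset.subset_univ _, ?_⟩
        have h1 := hsum (Finset.univ.filter (fun t => ε.1 t = 1))
        have h3 : ∀ t, (if t ∈ Finset.univ.filter (fun t => ε.1 t = 1) then (1 : ℤˣ) else -1) =
            ε.1 t := by
          intro t
          rcases Int.units_eq_one_or (ε.1 t) with h | h <;> simp [h]
        simp_rw [h3, ε.2] at h1
        rcases Int.units_eq_one_or δ with rfl | rfl
        · simp at h1 hk; omega
        · simp at h1 hk; omega⟩
      invFun := fun s => ⟨fun t => if t ∈ s.1 then 1 else -1, by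
        have h1 := (Finset.mem_powersetCard.1 s.2).2
        rw [hsum, h1, hr]
        rcases Int.units_eq_one_or δ with rfl | rfl
        · simp [hk]; ring
        · simp [hk]⟩
      left_inv := fun ε => by
        ext t
        rcases Int.units_eq_one_or (ε.1 t) with h | h <;> simp [h]
      right_inv := fun s => by
        ext t
        simp }
  rw [Nat.card_congr e, Nat.card_eq_fintype_card, Fintype.card_coe, Finset.card_powersetCard,
    Finset.card_univ, hr]
  rw [show (2 * r + 1 + 1) / 2 = r + 1 by omega]
  rcases Int.units_eq_one_or δ with rfl | rfl
  · simp [hk]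
  · simp only [hk]
    exact (Nat.choose_symm_half r).symm

lemma ncard_invariantSHDS (hF : Nat.card F % 4 = 3) :
    (invariantSHDS F).ncard = 4 * (Nat.card F).choose ((Nat.card F + 1) / 2) := by
  have h2 : (2 : F) ≠ 0 := two_ne_zero_of_odd (odd_card_of_card hF)
  obtain ⟨η, hη⟩ : ∃ η : ℤˣ, quadraticChar F 2 = η := by
    rcases quadraticChar_dichotomy h2 with h | h
    · exact ⟨1, h⟩
    · exact ⟨-1, h⟩
  -- The pair x consists of α and β; only α constrains ε.
  let P := Σ x : ℤˣ × ℤˣ, {ε : F → ℤˣ // ∑ t, (ε t : ℤ) = (η * x.1 : ℤˣ)}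
  let f : P → invariantSHDS F := fun x => ⟨invSet x.1.1 x.1.2 x.2.1,
    (isSkewHadamard_invSet_iff hF).2 (by rw [x.2.2, hη]; push_cast; rfl),
    fun g hg => image_invSet hF hg⟩
  have hf : Function.Bijective f := by
    constructor
    · rintro ⟨⟨α, β⟩, ε, hε⟩ ⟨⟨α', β'⟩, ε', hε'⟩ h
      obtain ⟨h1, h3, h4⟩ := invSet_injective hF (Subtype.ext_iff.1 h)
      simp only at h1 h3 h4
      subst h1 h3 h4
      rfl
    · rintro ⟨D, hD, hA⟩
      obtain ⟨α, β, ε, rfl⟩ := exists_eq_invSet hF hD.isSkew hA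
      have h1 := (isSkewHadamard_invSet_iff hF).1 hD
      exact ⟨⟨⟨α, β⟩, ε, by rw [h1, hη]; push_cast; rfl⟩, rfl⟩
  rw [← Nat.card_coe_set_eq, ← Nat.card_congr (Equiv.ofBijective f hf), Nat.card_sigma]
  have hodd : Odd (Fintype.card F) := by
    rw [← Nat.card_eq_fintype_card]; exact odd_card_of_card hF
  simp_rw [card_signs_sum_eq hodd, Finset.sum_const, Finset.card_univ]
  rw [Nat.card_eq_fintype_card]
  rfl

end Count

/-! ### Conjugacy of `p`-subgroups -/

section GroupTheory

variable {G : Type*} [Group G]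

lemma relIndex_le_card_of_fun {H K : Subgroup G} {X : Type*} [Finite X] (f : K → X)
    (hf : ∀ a b : K, f a = f b → (a : G)⁻¹ * b ∈ H) : H.relIndex K ≤ Nat.card X := by
  rw [Subgroup.relIndex, Subgroup.index]
  refine Nat.card_le_card_of_injective (fun x : K ⧸ H.subgroupOf K => f x.out) fun x y hxy => ?_
  rw [← QuotientGroup.out_eq' x, ← QuotientGroup.out_eq' y, QuotientGroup.eq,
    Subgroup.mem_subgroupOf]
  simpa using hf _ _ hxy

/-- Used for contradictions: a large K inside R cannot meet a subgroup of small index in only few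
elements. -/
lemma card_le_card_inf_mul_relIndex [Finite G] {H K R : Subgroup G} (hK : K ≤ R) :
    Nat.card K ≤ Nat.card (H ⊓ K : Subgroup G) * H.relIndex R := by
  have h1 := Subgroup.card_mul_index (H.subgroupOf K)
  have h2 : Nat.card (H.subgroupOf K) = Nat.card (H ⊓ K : Subgroup G) := by
    rw [← Subgroup.inf_subgroupOf_right]
    exact Nat.card_congr (Subgroup.subgroupOfEquivOfLe inf_le_right).toEquiv
  rw [← h1, h2]
  exact Nat.mul_le_mul_left _ (Subgroup.relIndex_le_of_le_right hK Subgroup.index_ne_zero_of_finite)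

lemma card_map_conj (H : Subgroup G) (g : G) :
    Nat.card (H.map (MulAut.conj g).toMonoidHom) = Nat.card H :=
  Subgroup.card_map_of_injective (MulAut.conj g).injective

/-- If no `p`-subgroup of the normalizer of `P` in `S` contains a further conjugate of `P`, then
every conjugate of `P` contained in `S` is conjugate to `P` by an element of `S`. -/
lemma exists_mul_mem_normalizer [Finite G] {p : ℕ} [Fact p.Prime] {S P : Subgroup G} (hPS : P ≤ S)
    (hP : IsPGroup p P)
    (h : ∀ R : Subgroup G, P ≤ R → R ≤ S → R ≤ Subgroup.normalizer (P : Set G) → IsPGroup p R →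
      ∀ g, P.map (MulAut.conj g).toMonoidHom ≤ R → P.map (MulAut.conj g).toMonoidHom = P)
    {g : G} (hg : P.map (MulAut.conj g).toMonoidHom ≤ S) :
    ∃ x ∈ S, x * g ∈ Subgroup.normalizer (P : Set G) := by
  obtain ⟨Q, hQ⟩ := (hP.comap_of_injective S.subtype S.subtype_injective).exists_le_sylow
  set Q' : Subgroup G := Q.toSubgroup.map S.subtype with hQ'
  have hQS : Q' ≤ S := by
    rintro _ ⟨y, -, rfl⟩
    exact y.2
  have hPQ : P ≤ Q' := fun y hy => ⟨⟨y, hPS hy⟩, hQ hy, rfl⟩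
  have hQp : IsPGroup p Q' := Q.isPGroup'.map _
  have hmem : ∀ y, P.map (MulAut.conj y).toMonoidHom = P →
      y ∈ Subgroup.normalizer (P : Set G) := fun y hy =>
    Subgroup.mem_normalizer_iff_map_conj_eq.2 hy
  have hnorm : Q' ≤ Subgroup.normalizer (P : Set G) := by
    set R := Q' ⊓ Subgroup.normalizer (P : Set G) with hR
    have hRQ : R.subgroupOf Q' = ⊤ := by
      have := hQp.isNilpotent
      by_contra hne
      -- A proper subgroup of a nilpotent group is smaller than its normalizer. An element y
      -- normalizing R sends P into R, hence onto P by `h`, so y already lies in R.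
      have hlt := Group.normalizerCondition_of_isNilpotent (G := Q') _ (lt_top_iff_ne_top.2 hne)
      obtain ⟨y, hy, hyR⟩ := SetLike.exists_of_lt hlt
      apply hyR
      rw [Subgroup.mem_subgroupOf, hR]
      refine ⟨y.2, hmem _ (h R (le_inf hPQ Subgroup.le_normalizer) (inf_le_left.trans hQS)
        inf_le_right (hQp.to_le inf_le_left) _ ?_)⟩
      rintro _ ⟨z, hz, rfl⟩
      have hzR : z ∈ R := ⟨hPQ hz, Subgroup.le_normalizer hz⟩
      exact (Subgroup.mem_normalizer_iff.1 hy ⟨z, hPQ hz⟩).1 hzR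
    rw [Subgroup.subgroupOf_eq_top] at hRQ
    exact hRQ.trans inf_le_right
  obtain ⟨Q₂, hQ₂⟩ := ((hP.map (MulAut.conj g).toMonoidHom).comap_of_injective S.subtype
    S.subtype_injective).exists_le_sylow
  -- Sylow's theorem in S moves the given conjugate of P into Q', which normalizes P, so `h` applies
  -- with R = Q'.
  obtain ⟨x, hx⟩ := MulAction.exists_smul_eq S Q₂ Q
  refine ⟨x, x.2, hmem _ (h Q' hPQ hQS hnorm hQp _ ?_)⟩
  rintro _ ⟨z, hz, rfl⟩
  have h1 : MulAut.conj g z ∈ P.map (MulAut.conj g).toMonoidHom := ⟨z, hz, rfl⟩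
  have h2 : (⟨_, hg h1⟩ : S) ∈ Q₂ := hQ₂ h1
  have h3 : x * ⟨_, hg h1⟩ * x⁻¹ ∈ Q := by
    rw [← hx]
    exact ⟨_, h2, rfl⟩
  refine ⟨_, h3, ?_⟩
  simp [mul_assoc]

end GroupTheory

/-! ### Fixed points of semilinear maps -/

section FixedPoints

variable {F : Type*} [Field F] [Finite F]

/-- For y outside the fixed field, (u, v) ↦ u + vy is injective on pairs of fixed elements. -/
lemma sq_card_fixed_le {τ : F ≃+* F} (hτ : τ ≠ RingEquiv.refl F) :
    Nat.card {x : F // τ x = x} ^ 2 ≤ Nat.card F := by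
  obtain ⟨y, hy⟩ : ∃ y, τ y ≠ y := by
    by_contra! h
    exact hτ (RingEquiv.ext h)
  rw [sq, ← Nat.card_prod]
  refine Nat.card_le_card_of_injective (fun x => x.1.1 + x.2.1 * y) ?_
  rintro ⟨⟨u, hu⟩, v, hv⟩ ⟨⟨u', hu'⟩, v', hv'⟩ h
  simp only at h
  have h1 := congrArg τ h
  simp only [map_add, map_mul, hu, hv, hu', hv'] at h1
  have h2 : (v - v') * (τ y - y) = 0 := by linear_combination h1 - h
  have h3 : v = v' := by
    rcases mul_eq_zero.1 h2 with h3 | h3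
    · exact sub_eq_zero.1 h3
    · exact absurd (sub_eq_zero.1 h3) hy
  subst h3
  have h4 : u = u' := by linear_combination h
  subst h4
  rfl

/-- The quotient of two differences of solutions is fixed by τ, so dividing by one non-zero
difference embeds the solution set in the fixed field. -/
lemma card_affine_fixed_le (τ : F ≃+* F) {k : F} (hk : k ≠ 0) (d : F) :
    Nat.card {x : F // k * τ x + d = x} ≤ Nat.card {x : F // τ x = x} := by
  by_cases h : ∃ x y : F, (k * τ x + d = x) ∧ (k * τ y + d = y) ∧ x ≠ y
  · obtain ⟨x, y, hx, hy, hxy⟩ := h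
    have hne : x - y ≠ 0 := sub_ne_zero.2 hxy
    have h1 : k * τ (x - y) = x - y := by rw [map_sub]; linear_combination hx - hy
    refine Nat.card_le_card_of_injective
      (fun z => ⟨(z.1 - y) / (x - y), ?_⟩) fun z w hzw => ?_
    · have h2 : k * τ (z.1 - y) = z.1 - y := by rw [map_sub]; linear_combination z.2 - hy
      rw [map_div₀]
      conv_rhs => rw [← h1, ← h2]
      rw [mul_div_mul_left _ _ hk]
    · have h3 := Subtype.ext_iff.1 hzw
      simp only [div_left_inj' hne, sub_left_inj] at h3
      exact Subtype.ext h3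
  · have h1 : Subsingleton {x : F // k * τ x + d = x} := by
      refine ⟨fun x y => Subtype.ext ?_⟩
      by_contra hxy
      exact h ⟨x, y, x.2, y.2, hxy⟩
    have h2 : Nonempty {x : F // τ x = x} := ⟨⟨0, map_zero τ⟩⟩
    exact (Finite.card_le_one_iff_subsingleton.2 h1).trans Nat.card_pos

lemma card_sigma_le {X : Type*} [Finite X] {Y : X → Type*} [∀ x, Finite (Y x)] {r s : ℕ}
    (hX : Nat.card X ≤ r) (hY : ∀ x, Nat.card (Y x) ≤ s) : Nat.card (Σ x, Y x) ≤ r * s := by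
  have := Fintype.ofFinite X
  rw [Nat.card_sigma]
  calc ∑ x, Nat.card (Y x) ≤ ∑ _x : X, s := Finset.sum_le_sum fun x _ => hY x
    _ = Nat.card X * s := by simp
    _ ≤ r * s := Nat.mul_le_mul_right _ hX

/-- By triangularity the coordinates of a fixed vector solve affine equations in turn, from the last
to the first, each with at most |Fix τ| solutions. -/
lemma card_fixed_nrm_le (τ : F ≃+* F) (k s : Fˣ) (m l : F) :
    Nat.card {v : Fin 3 → F // nrm τ k s m l v = v} ≤ Nat.card {x : F // τ x = x} ^ 3 := by
  set r := Nat.card {x : F // τ x = x} with hr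
  let X := {c : F // (k : F) * τ c + 0 = c}
  let Y : X → Type _ := fun c => {b : F // (k : F) * s * τ b + m * τ c.1 = b}
  let Z : (Σ c : X, Y c) → Type _ := fun x =>
    {a : F // (k : F) * s ^ 2 * τ a + (m * s * τ x.2.1 + l * τ x.1.1) = a}
  have hX : Nat.card X ≤ r := card_affine_fixed_le τ k.ne_zero 0
  have hY : ∀ c, Nat.card (Y c) ≤ r := fun c =>
    card_affine_fixed_le τ (mul_ne_zero k.ne_zero s.ne_zero) _
  have hZ : ∀ x, Nat.card (Z x) ≤ r := fun x =>
    card_affine_fixed_le τ (mul_ne_zero k.ne_zero (pow_ne_zero 2 s.ne_zero)) _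
  have hle : Nat.card (Σ x, Z x) ≤ r * r * r := card_sigma_le (card_sigma_le hX hY) hZ
  rw [pow_succ, sq]
  refine le_trans ?_ hle
  have hv : ∀ v : {v : Fin 3 → F // nrm τ k s m l v = v},
      ((k : F) * s ^ 2 * τ (v.1 0) + (m * s * τ (v.1 1) + l * τ (v.1 2)) = v.1 0) ∧
      ((k : F) * s * τ (v.1 1) + m * τ (v.1 2) = v.1 1) ∧ ((k : F) * τ (v.1 2) + 0 = v.1 2) := by
    intro v
    have h := v.2
    rw [nrm_apply] at h
    refine ⟨?_, congrFun h 1, ?_⟩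
    · rw [← add_assoc]; exact congrFun h 0
    · rw [add_zero]; exact congrFun h 2
  refine Nat.card_le_card_of_injective (fun v => (⟨⟨⟨v.1 2, (hv v).2.2⟩, ⟨v.1 1, (hv v).2.1⟩⟩,
    ⟨v.1 0, (hv v).1⟩⟩ : Σ x, Z x)) fun v w h => ?_
  have h2 := congrArg (fun x : Σ x, Z x => x.1.1.1) h
  have h1 := congrArg (fun x : Σ x, Z x => x.1.2.1) h
  have h0 := congrArg (fun x : Σ x, Z x => x.2.1) h
  apply Subtype.ext
  ext i
  fin_cases i
  · exact h0
  · exact h1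
  · exact h2

/-- The fixed vectors have the form (a, 0, 0). -/
lemma card_fixed_eAut_le {x : F} (hx : x ≠ 0) :
    Nat.card {v : Fin 3 → F // eAut x v = v} ≤ Nat.card F := by
  refine Nat.card_le_card_of_injective (fun v => v.1 0) fun v w h => ?_
  have hz : ∀ v : {v : Fin 3 → F // eAut x v = v}, v.1 2 = 0 ∧ v.1 1 = 0 := by
    intro v
    have h := v.2
    rw [eAut_apply] at h
    have h1 : v.1 1 + x * v.1 2 = v.1 1 := congrFun h 1
    have h2 : v.1 2 = 0 := by simpa [hx] using h1
    have h0 : v.1 0 + x * v.1 1 + x ^ 2 / 2 * v.1 2 = v.1 0 := congrFun h 0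
    exact ⟨h2, by simpa [hx, h2] using h0⟩
  apply Subtype.ext
  ext i
  fin_cases i
  · exact h
  · exact (hz v).2.trans (hz w).2.symm
  · exact (hz v).1.trans (hz w).1.symm

/-- The last coordinate shows that field automorphisms multiply along; elements with equal τ thus
differ by an F-linear map. -/
lemma ringEquiv_of_nrm_mul {τ₁ τ₂ τ₃ : F ≃+* F} {k₁ s₁ k₂ s₂ k₃ s₃ : Fˣ}
    {m₁ l₁ m₂ l₂ m₃ l₃ : F}
    (h : nrm τ₁ k₁ s₁ m₁ l₁ * nrm τ₂ k₂ s₂ m₂ l₂ = nrm τ₃ k₃ s₃ m₃ l₃) : τ₃ = τ₂.trans τ₁ := by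
  have h1 : ∀ c, (k₁ : F) * (τ₁ k₂ * τ₁ (τ₂ c)) = k₃ * τ₃ c := fun c => by
    have := congrFun (DFunLike.congr_fun h ![0, 0, c]) 2
    simpa [LinearEquiv.mul_apply, nrm_apply] using this
  have h2 := h1 1
  simp only [map_one, mul_one] at h2
  ext c
  apply mul_left_cancel₀ k₃.ne_zero
  rw [← h1, ← h2]
  simp [mul_assoc]

end FixedPoints

/-! ### Affine permutations -/

section Affine

variable {F : Type*} [Field F]

/-- The group of the affine permutations of `V` with linear parts in `Γ`. -/
def affine (Γ : Subgroup (AutV F)) : Subgroup (Equiv.Perm (Fin 3 → F)) where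
  carrier := {g | ∃ φ ∈ Γ, ∃ h, ∀ v, g v = φ v + h}
  one_mem' := ⟨1, Γ.one_mem, 0, fun v => by simp⟩
  mul_mem' := by
    rintro a b ⟨φ, hφ, h, ha⟩ ⟨χ, hχ, k, hb⟩
    refine ⟨φ * χ, Γ.mul_mem hφ hχ, φ k + h, fun v => ?_⟩
    rw [Equiv.Perm.mul_apply, ha, hb, map_add, LinearEquiv.mul_apply, add_assoc]
  inv_mem' := by
    rintro a ⟨φ, hφ, h, ha⟩
    refine ⟨φ⁻¹, Γ.inv_mem hφ, -(φ⁻¹ h), fun v => ?_⟩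
    rw [Equiv.Perm.inv_eq_iff_eq, ha, map_add, map_neg, ← LinearEquiv.mul_apply,
      ← LinearEquiv.mul_apply]
    simp

lemma mem_affine {Γ : Subgroup (AutV F)} {g : Equiv.Perm (Fin 3 → F)} :
    g ∈ affine Γ ↔ ∃ φ ∈ Γ, ∃ h, ∀ v, g v = φ v + h := Iff.rfl

lemma mem_affine_bot {g : Equiv.Perm (Fin 3 → F)} : g ∈ affine (⊥ : Subgroup (AutV F)) ↔
    ∃ h, ∀ v, g v = v + h := by
  rw [mem_affine]
  simp [Subgroup.mem_bot]

lemma affine_mono {Γ Δ : Subgroup (AutV F)} (h : Γ ≤ Δ) : affine Γ ≤ affine Δ :=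
  fun _ ⟨φ, hφ, k, hg⟩ => ⟨φ, h hφ, k, hg⟩

lemma linear_part_unique {φ χ : AutV F} {h k : Fin 3 → F} (H : ∀ v, φ v + h = χ v + k) :
    φ = χ ∧ h = k := by
  have h0 := H 0
  simp only [map_zero, zero_add] at h0
  refine ⟨LinearEquiv.ext fun v => ?_, h0⟩
  have := H v
  rw [h0] at this
  exact add_right_cancel this

/-- The linear permutation given by an automorphism. -/
def linPerm : AutV F →* Equiv.Perm (Fin 3 → F) where
  toFun φ := φ.toEquiv
  map_one' := rfl
  map_mul' _ _ := rfl

lemma linPerm_apply (φ : AutV F) (v : Fin 3 → F) : linPerm φ v = φ v := rfl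

lemma linPerm_mem_affine {Γ : Subgroup (AutV F)} {φ : AutV F} (h : φ ∈ Γ) :
    linPerm φ ∈ affine Γ := ⟨φ, h, 0, fun v => by rw [linPerm_apply, add_zero]⟩

/-- The translation by `h`. -/
def transPerm (h : Fin 3 → F) : Equiv.Perm (Fin 3 → F) := Equiv.addRight h

lemma transPerm_apply (h v : Fin 3 → F) : transPerm h v = v + h := rfl

lemma transPerm_mem (h : Fin 3 → F) : transPerm h ∈ affine (⊥ : Subgroup (AutV F)) :=
  mem_affine_bot.2 ⟨h, fun _ => rfl⟩

lemma eq_transPerm_mul_linPerm {g : Equiv.Perm (Fin 3 → F)} {φ : AutV F} {h : Fin 3 → F}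
    (hg : ∀ v, g v = φ v + h) : g = transPerm h * linPerm φ := by
  ext1 v
  rw [hg, Equiv.Perm.mul_apply, transPerm_apply, linPerm_apply]

lemma exists_pow_apply {g : Equiv.Perm (Fin 3 → F)} {φ : AutV F} {h : Fin 3 → F}
    (hg : ∀ v, g v = φ v + h) (n : ℕ) : ∃ k, ∀ v, (g ^ n) v = (φ ^ n) v + k := by
  induction n with
  | zero => exact ⟨0, fun v => by simp⟩
  | succ n ih =>
    obtain ⟨k, hk⟩ := ih
    refine ⟨(φ ^ n) h + k, fun v => ?_⟩
    rw [pow_succ, Equiv.Perm.mul_apply, hg, hk, map_add, pow_succ, LinearEquiv.mul_apply,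
      add_assoc]

lemma conj_translations_comm (w : Equiv.Perm (Fin 3 → F)) :
    ∀ a ∈ (affine (⊥ : Subgroup (AutV F))).map (MulAut.conj w).toMonoidHom,
    ∀ b ∈ (affine (⊥ : Subgroup (AutV F))).map (MulAut.conj w).toMonoidHom, a * b = b * a := by
  rintro _ ⟨a, ha, rfl⟩ _ ⟨b, hb, rfl⟩
  rw [← map_mul, ← map_mul]
  congr 1
  obtain ⟨h, hh⟩ := mem_affine_bot.1 ha
  obtain ⟨k, hk⟩ := mem_affine_bot.1 hb
  ext1 v
  rw [Equiv.Perm.mul_apply, Equiv.Perm.mul_apply, hh, hk, hh, hk, add_right_comm]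

lemma inv_mul_mem_affine {a b : Equiv.Perm (Fin 3 → F)} {φ χ : AutV F} {h k : Fin 3 → F}
    (ha : ∀ v, a v = φ v + h) (hb : ∀ v, b v = χ v + k) {Γ : Subgroup (AutV F)}
    (hΓ : φ⁻¹ * χ ∈ Γ) : a⁻¹ * b ∈ affine Γ := by
  refine ⟨φ⁻¹ * χ, hΓ, φ⁻¹ (k - h), fun v => ?_⟩
  rw [Equiv.Perm.mul_apply, Equiv.Perm.inv_eq_iff_eq, ha, hb, map_add, ← LinearEquiv.mul_apply,
    ← LinearEquiv.mul_apply, mul_inv_cancel_left, mul_inv_cancel, LinearEquiv.coe_one, id_eq,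
    add_assoc, sub_add_cancel]

variable [Finite F]

instance finite_autV : Finite (AutV F) := DFunLike.finite _

lemma card_affine (Γ : Subgroup (AutV F)) :
    Nat.card (affine Γ) = Nat.card Γ * Nat.card F ^ 3 := by
  let f : Γ × (Fin 3 → F) → affine Γ := fun x => ⟨transPerm x.2 * linPerm x.1.1,
    x.1.1, x.1.2, x.2, fun v => rfl⟩
  have hf : Function.Bijective f := by
    constructor
    · rintro ⟨⟨φ, hφ⟩, h⟩ ⟨⟨χ, hχ⟩, k⟩ H
      have h1 := Subtype.ext_iff.1 H
      obtain ⟨rfl, rfl⟩ := linear_part_unique fun v => DFunLike.congr_fun h1 v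
      rfl
    · rintro ⟨g, φ, hφ, h, hg⟩
      exact ⟨⟨⟨φ, hφ⟩, h⟩, Subtype.ext (eq_transPerm_mul_linPerm hg).symm⟩
  rw [← Nat.card_congr (Equiv.ofBijective f hf), Nat.card_prod, card_fin_three]

lemma card_groupE (h2 : (2 : F) ≠ 0) : Nat.card (groupE F) = Nat.card F := by
  let f : F → groupE F := fun x => ⟨eAut x, (mem_groupE h2).2 ⟨x, rfl⟩⟩
  have hf : Function.Bijective f := by
    refine ⟨fun x y h => eAut_injective (Subtype.ext_iff.1 h), ?_⟩
    rintro ⟨g, hg⟩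
    obtain ⟨x, rfl⟩ := (mem_groupE h2).1 hg
    exact ⟨x, rfl⟩
  exact (Nat.card_congr (Equiv.ofBijective f hf)).symm

/-- A permutation normalizing the translations is affine. -/
lemma exists_affine_of_conj {w : Equiv.Perm (Fin 3 → F)}
    (hw : (affine (⊥ : Subgroup (AutV F))).map (MulAut.conj w).toMonoidHom ≤ affine ⊥) :
    ∃ (φ : AutV F) (h : Fin 3 → F), ∀ v, w v = φ v + h := by
  have h1 : ∀ h, ∃ h', ∀ v, w (v + h) = w v + h' := by
    intro h
    obtain ⟨h', hh⟩ := mem_affine_bot.1 (hw ⟨transPerm h, transPerm_mem h, rfl⟩)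
    refine ⟨h', fun v => ?_⟩
    have := hh (w v)
    simpa [transPerm_apply] using this
  have h2 : ∀ v h, w (v + h) = w v + (w h - w 0) := by
    intro v h
    obtain ⟨h', hh⟩ := h1 h
    have h3 := hh 0
    rw [zero_add] at h3
    rw [hh, h3]
    abel
  let f : (Fin 3 → F) →+ (Fin 3 → F) :=
    { toFun := fun v => w v - w 0
      map_zero' := sub_self _
      map_add' := fun v h => by rw [h2]; abel }
  have hinj : Function.Injective f := fun v v' h => w.injective (sub_left_injective h)
  refine ⟨LinearEquiv.ofBijective f.toIntLinearMap
    ⟨hinj, Finite.injective_iff_surjective.1 hinj⟩, w 0, fun v => ?_⟩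
  change w v = w v - w 0 + w 0
  rw [sub_add_cancel]

/-- Abelian groups of affine permutations of the same order as the group of translations consist of
translations, provided that non-trivial linear parts have few fixed points. -/
lemma le_translations_of_comm {R V' : Subgroup (Equiv.Perm (Fin 3 → F))} (hV' : V' ≤ R)
    (hcomm : ∀ a ∈ V', ∀ b ∈ V', a * b = b * a) (hcard : Nat.card V' = Nat.card F ^ 3)
    (hfix : ∀ r ∈ R, r ∉ affine (⊥ : Subgroup (AutV F)) → ∃ (φ : AutV F) (h : Fin 3 → F),
      (∀ v, r v = φ v + h) ∧ Nat.card {v // φ v = v} *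
        (affine (⊥ : Subgroup (AutV F))).relIndex R < Nat.card F ^ 3) :
    V' ≤ affine ⊥ := by
  intro r hr
  by_contra hrT
  obtain ⟨φ, h, hφ, hlt⟩ := hfix r (hV' hr) hrT
  have h1 := card_le_card_inf_mul_relIndex (H := affine (⊥ : Subgroup (AutV F))) hV'
  rw [hcard] at h1
  have h2 : Nat.card (affine (⊥ : Subgroup (AutV F)) ⊓ V' :) ≤ Nat.card {v // φ v = v} := by
    -- A translation commuting with r is by a vector fixed by φ, and that vector determines it.
    have h3 : ∀ t : (affine (⊥ : Subgroup (AutV F)) ⊓ V' :), φ (t.1 0) = t.1 0 := by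
      rintro ⟨t, ht, htV⟩
      obtain ⟨k, hk⟩ := mem_affine_bot.1 ht
      have h4 := DFunLike.congr_fun (hcomm r hr t htV) 0
      rw [Equiv.Perm.mul_apply, Equiv.Perm.mul_apply, hφ, hφ, hk (φ 0 + h), hk 0] at h4
      simp only [map_zero, zero_add] at h4
      change φ (t 0) = t 0
      rw [hk, zero_add]
      rw [add_comm h] at h4
      exact add_right_cancel h4
    refine Nat.card_le_card_of_injective (fun t => ⟨t.1 0, h3 t⟩) ?_
    rintro ⟨t, ht, htV⟩ ⟨t', ht', htV'⟩ he
    obtain ⟨k, hk⟩ := mem_affine_bot.1 ht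
    obtain ⟨k', hk'⟩ := mem_affine_bot.1 ht'
    have h5 : t 0 = t' 0 := Subtype.ext_iff.1 he
    rw [hk, hk', zero_add, zero_add] at h5
    apply Subtype.ext
    ext1 v
    change t v = t' v
    rw [hk, hk', h5]
  exact absurd (h1.trans (Nat.mul_le_mul_right _ h2)) (not_le.2 hlt)

lemma relIndex_translations_le (h2 : (2 : F) ≠ 0) :
    (affine (⊥ : Subgroup (AutV F))).relIndex (affine (groupE F)) ≤ Nat.card F := by
  choose φ hφ h hh using fun r : affine (groupE F) => r.2
  refine (relIndex_le_card_of_fun (X := groupE F) (fun r => ⟨φ r, hφ r⟩) fun a b hab =>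
    inv_mul_mem_affine (hh a) (hh b) ?_).trans (card_groupE h2).le
  have h3 : φ a = φ b := Subtype.ext_iff.1 hab
  rw [h3, inv_mul_cancel]
  exact one_mem _

lemma card_conj_translations (w : Equiv.Perm (Fin 3 → F)) :
    Nat.card ((affine (⊥ : Subgroup (AutV F))).map (MulAut.conj w).toMonoidHom) =
      Nat.card F ^ 3 := by
  rw [card_map_conj, card_affine]
  simp

/-- The normalizer of the group `V E` consists of affine maps whose linear parts normalize `E`. -/
lemma exists_of_mem_normalizer (h2 : (2 : F) ≠ 0) {w : Equiv.Perm (Fin 3 → F)}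
    (hw : w ∈ Subgroup.normalizer (affine (groupE F) : Set (Equiv.Perm (Fin 3 → F)))) :
    ∃ (φ : AutV F) (h : Fin 3 → F), (∀ v, w v = φ v + h) ∧
      ∀ x, ∃ y, φ * eAut x = eAut y * φ := by
  have hE : ∀ g ∈ affine (groupE F), w * g * w⁻¹ ∈ affine (groupE F) := fun g hg =>
    (Subgroup.mem_normalizer_iff.1 hw g).1 hg
  have hq : 1 < Nat.card F := Finite.one_lt_card
  obtain ⟨φ, h, hφ⟩ : ∃ (φ : AutV F) (h : Fin 3 → F), ∀ v, w v = φ v + h := by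
    apply exists_affine_of_conj
    refine le_translations_of_comm (R := affine (groupE F)) ?_ (conj_translations_comm w)
      (card_conj_translations w) ?_
    · rintro _ ⟨t, ht, rfl⟩
      exact hE t (affine_mono (bot_le (a := groupE F)) ht)
    · rintro r ⟨φ, hφ, h, hr⟩ hrT
      refine ⟨φ, h, hr, ?_⟩
      obtain ⟨x, rfl⟩ := (mem_groupE h2).1 hφ
      have hx : x ≠ 0 := by
        rintro rfl
        exact hrT (mem_affine_bot.2 ⟨h, fun v => by rw [hr, eAut_zero]; rfl⟩)
      calc _ ≤ Nat.card F * Nat.card F :=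
            Nat.mul_le_mul (card_fixed_eAut_le hx) (relIndex_translations_le h2)
        _ < Nat.card F ^ 3 := by
            rw [← sq]
            exact Nat.pow_lt_pow_right hq (by norm_num)
  refine ⟨φ, h, hφ, fun x => ?_⟩
  obtain ⟨χ, hχ, k, hk⟩ := hE _ (linPerm_mem_affine ((mem_groupE h2).2 ⟨x, rfl⟩))
  obtain ⟨y, rfl⟩ := (mem_groupE h2).1 hχ
  refine ⟨y, (linear_part_unique (h := h) (k := eAut y h + k) fun v => ?_).1⟩
  have h3 := hk (w v)
  rw [Equiv.Perm.mul_apply, Equiv.Perm.inv_def, Equiv.symm_apply_apply, Equiv.Perm.mul_apply,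
    linPerm_apply, hφ,
    hφ, map_add, add_assoc] at h3
  exact h3

end Affine

/-! ### Isomorphisms of the translation designs -/

section Isomorphism

variable {F : Type*} [Field F] [Fintype F] [DecidableEq F]

/-- A sign function on a field of characteristic `p` with sum `±1` has no non-trivial periods. -/
lemma eq_zero_of_period {p n : ℕ} (hp : p.Prime) (hF : Nat.card F = p ^ n) (hn : n ≠ 0)
    {ε : F → ℤˣ} {u : ℤˣ} (hε : ∑ t, (ε t : ℤ) = u) {d : F} (hd : ∀ t, ε (t + d) = ε t) :
    d = 0 := by
  by_contra hd0
  have := Fact.mk hp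
  have hc : CharP F p := charP_of_card_eq_prime_pow (f := n) (by rw [← Nat.card_eq_fintype_card, hF])
  -- Shifting by d ≠ 0 acts on X with p-th power 1 and without fixed points, so p divides |X|. Then
  -- p divides 2|X| - q = ∑ ε = ±1, a contradiction.
  let X := {t : F // ε t = 1}
  let f : Function.End X := fun t => ⟨t.1 + d, by rw [hd, t.2]⟩
  have hpow : ∀ (k : ℕ) (t : X), ((f ^ k) t).1 = t.1 + k * d := by
    intro k
    induction k with
    | zero => intro t; change t.1 = _; simp
    | succ k ih =>
      intro t
      rw [pow_succ]
      change ((f ^ k) (f t)).1 = _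
      rw [ih]
      change t.1 + d + k * d = _
      push_cast
      ring
  have hf : f ^ p ^ 1 = 1 := by
    funext t
    apply Subtype.ext
    rw [hpow, pow_one, CharP.cast_eq_zero, zero_mul, add_zero]
    rfl
  have h1 := Equiv.Perm.card_fixedPoints_modEq hf
  have h3 : Fintype.card (Function.fixedPoints f) = 0 := by
    rw [Fintype.card_eq_zero_iff]
    refine ⟨fun ⟨t, ht⟩ => hd0 ?_⟩
    have := Subtype.ext_iff.1 ht
    exact left_eq_add.1 this.symm
  rw [h3] at h1
  have h4 : p ∣ Fintype.card X := (Nat.modEq_zero_iff_dvd).1 h1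
  have h5 : ∑ t, (ε t : ℤ) = 2 * (Fintype.card X : ℤ) - Nat.card F := by
    have : ∀ t, (ε t : ℤ) = 2 * (if ε t = 1 then 1 else 0) - 1 := by
      intro t
      rcases Int.units_eq_one_or (ε t) with h | h <;> simp [h]
    simp_rw [this, Finset.sum_sub_distrib, ← Finset.mul_sum]
    simp [X, Fintype.card_subtype]
  have h6 : (p : ℤ) ∣ u := by
    rw [← hε, h5, hF]
    refine dvd_sub (Dvd.dvd.mul_left (Int.natCast_dvd_natCast.2 h4) _) ?_
    exact Int.natCast_dvd_natCast.2 (dvd_pow_self p hn)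
  have h7 : IsUnit (p : ℤ) := isUnit_of_dvd_unit h6 u.isUnit
  rw [Int.isUnit_iff] at h7
  have := hp.two_le
  omega

lemma quadraticChar_ringEquiv (τ : F ≃+* F) (x : F) :
    quadraticChar F (τ x) = quadraticChar F x := by
  by_cases hx : x = 0
  · simp [hx]
  have hx' : τ x ≠ 0 := by simpa using hx
  have h : quadraticChar F (τ x) = 1 ↔ quadraticChar F x = 1 := by
    rw [quadraticChar_one_iff_isSquare hx, quadraticChar_one_iff_isSquare hx']
    constructor
    · rintro ⟨r, hr⟩
      exact ⟨τ.symm r, τ.injective (by simp [hr])⟩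
    · rintro ⟨r, rfl⟩
      exact ⟨τ r, map_mul _ _ _⟩
  rcases quadraticChar_dichotomy hx with h1 | h1 <;>
    rcases quadraticChar_dichotomy hx' with h3 | h3 <;> simp_all [-quadraticChar_apply]

variable {α β α' β' : ℤˣ} {ε ε' : F → ℤˣ}

/-- Compare the signs of (-tc/2, 0, c) and of its image. The right side is free of `c`, so varying
`c` produces periods of `ε'`. -/
lemma sign_eq_of_semilin_image (hF : Nat.card F % 4 = 3) {τ : F ≃+* F} {k s : Fˣ} {m : F}
    {L : F →+ F} (h : semilin τ k s m L '' invSet α β ε = invSet α' β' ε') {c : F} (hc : c ≠ 0)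
    (t : F) : (ε' (m ^ 2 / k ^ 2 + s ^ 2 * τ t - 2 * L c / (k * τ c)) : ℤ) =
      quadraticChar F k * ε t := by
  have h2 : (2 : F) ≠ 0 := two_ne_zero_of_odd (odd_card_of_card hF)
  have h1 := setSign_image h ![-(t * c) / 2, 0, c]
  rw [setSign_invSet hF, setSign_invSet hF, semilin_apply] at h1
  have hτc : τ c ≠ 0 := by simpa using hc
  have hk := k.ne_zero
  have hτ2 : τ 2 = 2 := map_ofNat τ 2
  have e1 : (-(2 * (-(t * c) / 2) * c)) / c ^ 2 = t := by field_simp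
  have e2 : ((m * τ c) ^ 2 - 2 * (k * s ^ 2 * (-(τ t * τ c) / 2) + L c) * (k * τ c)) /
      (k * τ c) ^ 2 = m ^ 2 / k ^ 2 + s ^ 2 * τ t - 2 * L c / (k * τ c) := by
    field_simp; ring
  simp [invSign, hc, -quadraticChar_apply, hτ2, quadraticChar_ringEquiv] at h1
  rw [e1, e2] at h1
  have hη := quadraticChar_sq_one hc
  have hηk := quadraticChar_sq_one hk
  have h3 : quadraticChar F c ^ 2 * quadraticChar F k ^ 2 *
      (ε' (m ^ 2 / k ^ 2 + s ^ 2 * τ t - 2 * L c / (k * τ c)) : ℤ) =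
      quadraticChar F c ^ 2 * (quadraticChar F k * ε t) := by
    linear_combination (quadraticChar F c * quadraticChar F k) * h1
  rw [hη, hηk] at h3
  simpa [-quadraticChar_apply] using h3

lemma exists_sum_eq_unit (hF : Nat.card F % 4 = 3) (hD : IsSkewHadamard (invSet α β ε)) :
    ∃ u : ℤˣ, ∑ t, (ε t : ℤ) = u := by
  have h2 : (2 : F) ≠ 0 := two_ne_zero_of_odd (odd_card_of_card hF)
  rw [isSkewHadamard_invSet_iff hF] at hD
  rcases quadraticChar_dichotomy h2 with h | h
  · exact ⟨α, by rw [hD, h, one_mul]⟩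
  · exact ⟨-α, by rw [hD, h]; simp⟩

/-- An automorphism normalizing `E` and mapping one invariant skew Hadamard difference set to
another one is semilinear. -/
lemma semilin_eq_nrm_of_image {p n : ℕ} (hp : p.Prime) (hFp : Nat.card F = p ^ n) (hn : n ≠ 0)
    (hF : Nat.card F % 4 = 3) {τ : F ≃+* F} {k s : Fˣ} {m : F}
    {L : F →+ F} (h : semilin τ k s m L '' invSet α β ε = invSet α' β' ε')
    (hD : IsSkewHadamard (invSet α' β' ε')) : semilin τ k s m L = nrm τ k s m (L 1) := by
  have h2 : (2 : F) ≠ 0 := two_ne_zero_of_odd (odd_card_of_card hF)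
  obtain ⟨u, hu⟩ := exists_sum_eq_unit hF hD
  have hL : ∀ c, c ≠ 0 → L c = L 1 * τ c := by
    intro c hc
    have hτc : τ c ≠ 0 := by simpa using hc
    have hper : ∀ t, ε' (t + (2 * L 1 / k - 2 * L c / (k * τ c))) = ε' t := by
      intro t
      -- Chosen so that the sign relation for c = 1 has argument exactly t on its left side.
      set t' := τ.symm ((t - m ^ 2 / k ^ 2 + 2 * L 1 / k) / s ^ 2) with ht'
      have hk := k.ne_zero
      have hs := s.ne_zero
      have e0 : (s : F) ^ 2 * τ t' = t - m ^ 2 / k ^ 2 + 2 * L 1 / k := by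
        rw [ht', RingEquiv.apply_symm_apply]
        field_simp
      have h3 := sign_eq_of_semilin_image hF h hc t'
      have h4 := sign_eq_of_semilin_image hF h one_ne_zero t'
      rw [← h4, e0, map_one τ, mul_one] at h3
      apply Units.ext
      convert h3 using 3 <;> ring
    have h5 := eq_zero_of_period hp hFp hn hu hper
    have hk := k.ne_zero
    field_simp at h5
    have h6 : (2 : F) * (L 1 * τ c - L c) = 0 := by linear_combination h5
    have h7 := (mul_eq_zero.1 h6).resolve_left h2
    linear_combination -h7
  apply semilin_eq_nrm h2
  intro r c
  by_cases hr : r = 0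
  · simp [hr]
  by_cases hc : c = 0
  · simp [hc]
  rw [hL c hc, hL _ (mul_ne_zero (mul_ne_zero hr hr) hc), map_mul]
  ring

/-- A linear `p`-element stabilizing an invariant skew Hadamard difference set and normalizing `A`
lies in `E`. -/
lemma nrm_mem_groupE {p n : ℕ} (hp : p.Prime) (hFp : Nat.card F = p ^ n) (hn : n ≠ 0)
    (hF : Nat.card F % 4 = 3) {k s : Fˣ} {m l : F}
    (h : nrm (RingEquiv.refl F) k s m l '' invSet α β ε = invSet α β ε)
    (hD : IsSkewHadamard (invSet α β ε)) {j : ℕ}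
    (hj : nrm (RingEquiv.refl F) k s m l ^ p ^ j = 1) :
    nrm (RingEquiv.refl F) k s m l ∈ groupE F := by
  have h2 : (2 : F) ≠ 0 := two_ne_zero_of_odd (odd_card_of_card hF)
  have := Fact.mk hp
  have hc : CharP F p := charP_of_card_eq_prime_pow (f := n) (by rw [← Nat.card_eq_fintype_card, hFp])
  -- The field has no non-trivial roots of unity of p-power order; applied to the diagonal entries
  -- this makes the map unipotent.
  have hone : ∀ x : F, x ^ p ^ j = 1 → x = 1 := by
    intro x hx
    have h3 : (x - 1) ^ p ^ j = 0 := by rw [sub_pow_char_pow, hx, one_pow, sub_self]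
    exact sub_eq_zero.1 (eq_zero_of_pow_eq_zero h3)
  set φ := nrm (RingEquiv.refl F) k s m l with hφ
  have hp2 : ∀ (i : ℕ) v, (φ ^ i) v 2 = (k : F) ^ i * v 2 := by
    intro i
    induction i with
    | zero => intro v; simp
    | succ i ih =>
      intro v
      rw [pow_succ, LinearEquiv.mul_apply, ih, hφ, nrm_apply]
      simp
      ring
  have hp1 : ∀ (i : ℕ) v, v 2 = 0 → (φ ^ i) v 1 = ((k : F) * s) ^ i * v 1 := by
    intro i
    induction i with
    | zero => intro v _; simp
    | succ i ih =>
      intro v hv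
      rw [pow_succ, LinearEquiv.mul_apply, ih _ (by rw [hφ, nrm_apply]; simp [hv]), hφ, nrm_apply]
      simp [hv]
      ring
  have hk : (k : F) = 1 := by
    apply hone
    have := hp2 (p ^ j) ![0, 0, 1]
    rw [hj] at this
    simpa using this.symm
  have hs : (s : F) = 1 := by
    apply hone
    have := hp1 (p ^ j) ![0, 1, 0] (by simp)
    rw [hj, hk, one_mul] at this
    simpa using this.symm
  obtain ⟨u, hu⟩ := exists_sum_eq_unit hF hD
  -- With k = s = 1 the sign relation makes m² - 2l a period of ε; its vanishing gives the corner
  -- entry l = m²/2 of E(m).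
  have h3 : m ^ 2 - 2 * l = 0 := by
    apply eq_zero_of_period hp hFp hn hu
    intro t
    apply Units.ext
    have h4 := sign_eq_of_semilin_image hF h one_ne_zero t
    rw [hk, hs] at h4
    simp at h4
    convert h4 using 3
    ring
  rw [mem_groupE h2]
  refine ⟨m, ?_⟩
  have h4 : l = m ^ 2 / 2 := by field_simp; linear_combination -h3
  have hk' : k = 1 := Units.ext hk
  have hs' : s = 1 := Units.ext hs
  rw [hφ, hk', hs', h4]
  rfl

end Isomorphism

/-! ### Design isomorphisms and orbits of the normalizer of A -/

section IsomorphismClasses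

lemma image_translationDesign {F : Type*} [Field F] {D : Set (Fin 3 → F)}
    {w : Equiv.Perm (Fin 3 → F)} {φ : AutV F} {h : Fin 3 → F} (hw : ∀ v, w v = φ v + h) :
    (fun B : Set (Fin 3 → F) => w '' B) '' translationDesign D = translationDesign (φ '' D) := by
  have key : ∀ k, w '' ((fun d => d + k) '' D) = (fun d => d + (φ k + h)) '' (φ '' D) := by
    intro k
    rw [Set.image_image, Set.image_image]
    refine Set.image_congr fun d _ => ?_
    rw [hw, map_add, add_assoc]
  ext B
  constructor
  · rintro ⟨_, ⟨k, rfl⟩, rfl⟩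
    exact ⟨_, key k⟩
  · rintro ⟨k, rfl⟩
    refine ⟨_, ⟨φ.symm (k - h), rfl⟩, ?_⟩
    change w '' _ = _
    rw [key, LinearEquiv.apply_symm_apply, sub_add_cancel]

instance finite_ringAut {F : Type*} [Field F] [Finite F] : Finite (F ≃+* F) := DFunLike.finite _

variable {F : Type*} [Field F]

/-- The automorphism group of the translation design of `D`. -/
def designAut (D : Set (Fin 3 → F)) : Subgroup (Equiv.Perm (Fin 3 → F)) where
  carrier := {g | (fun B : Set (Fin 3 → F) => g '' B) '' translationDesign D = translationDesign D}
  one_mem' := by simp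
  mul_mem' {a b} ha hb := by
    change _ = _ at ha hb
    change _ = _
    have h : (fun B : Set (Fin 3 → F) => (a * b : Equiv.Perm _) '' B) =
        (fun B => a '' B) ∘ (fun B => b '' B) := by
      funext B
      exact Set.image_comp a b B
    rw [h, Set.image_comp, hb, ha]
  inv_mem' {a} ha := by
    change _ = _ at ha
    change _ = _
    conv_lhs => rw [← ha]
    rw [Set.image_image]
    simp [Set.image_image]

lemma mem_designAut {D : Set (Fin 3 → F)} {g : Equiv.Perm (Fin 3 → F)} : g ∈ designAut D ↔
    (fun B : Set (Fin 3 → F) => g '' B) '' translationDesign D = translationDesign D := Iff.rfl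

lemma mem_translationDesign_self (D : Set (Fin 3 → F)) : D ∈ translationDesign D :=
  ⟨0, by simp⟩

lemma affine_groupE_le_designAut {D : Set (Fin 3 → F)} (hA : ∀ g ∈ groupA F, g '' D = D) :
    affine (groupE F) ≤ designAut D := by
  rintro w ⟨φ, hφ, h, hw⟩
  rw [mem_designAut, image_translationDesign hw, hA φ (Subgroup.mem_sup_left hφ)]

lemma card_space_odd {F : Type*} [Finite F] (hF : Nat.card F % 4 = 3) : Odd (Nat.card (Fin 3 → F)) := by
  rw [card_fin_three]
  exact (odd_card_of_card hF).pow

lemma three_lt_card_space {F : Type*} [Finite F] (hF : Nat.card F % 4 = 3) :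
    3 < Nat.card (Fin 3 → F) := by
  rw [card_fin_three]
  have h1 : 3 ≤ Nat.card F := by omega
  calc 3 < 3 ^ 3 := by norm_num
    _ ≤ Nat.card F ^ 3 := Nat.pow_le_pow_left h1 3

variable [Fintype F] [DecidableEq F]

/-- φ(D) is a block of des(D') and itself a skew Hadamard difference set; the only such block is D'.
-/
lemma image_eq_of_affine {F : Type*} [Field F] [Finite F] (hF : Nat.card F % 4 = 3)
    {D D' : Set (Fin 3 → F)}
    (hD : IsSkewHadamard D) (hD' : IsSkewHadamard D') {w : Equiv.Perm (Fin 3 → F)} {φ : AutV F}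
    {h : Fin 3 → F} (hw : ∀ v, w v = φ v + h)
    (hdes : (fun B : Set (Fin 3 → F) => w '' B) '' translationDesign D = translationDesign D') :
    φ '' D = D' := by
  rw [image_translationDesign hw] at hdes
  refine hD'.eq_of_mem_translationDesign (three_lt_card_space hF) (card_space_odd hF)
    (hD.image_equiv φ.toAddEquiv) ?_
  rw [← hdes]
  exact mem_translationDesign_self _

/-- A design isomorphism normalizing `V E` is affine, and its linear part normalizes `A` and maps
the first difference set to the second one. -/
lemma exists_nrm_of_mem_normalizer {p n : ℕ} (hp : p.Prime) (hFp : Nat.card F = p ^ n) (hn : n ≠ 0)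
    (hF : Nat.card F % 4 = 3) {D D' : Set (Fin 3 → F)} (hD : D ∈ invariantSHDS F)
    (hD' : D' ∈ invariantSHDS F) {w : Equiv.Perm (Fin 3 → F)}
    (hw : w ∈ Subgroup.normalizer (affine (groupE F) : Set (Equiv.Perm (Fin 3 → F))))
    (hdes : (fun B : Set (Fin 3 → F) => w '' B) '' translationDesign D = translationDesign D') :
    ∃ (τ : F ≃+* F) (k s : Fˣ) (m l : F) (h : Fin 3 → F), (∀ v, w v = nrm τ k s m l v + h) ∧
      nrm τ k s m l '' D = D' := by
  have h2 : (2 : F) ≠ 0 := two_ne_zero_of_odd (odd_card_of_card hF)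
  obtain ⟨φ, h, hφ, hE⟩ := exists_of_mem_normalizer h2 hw
  obtain ⟨τ, k, s, m, L, rfl⟩ := exists_eq_semilin h2 hE
  have h3 := image_eq_of_affine hF hD.1 hD'.1 hφ hdes
  obtain ⟨α, β, ε, rfl⟩ := exists_eq_invSet hF hD.1.isSkew hD.2
  obtain ⟨α', β', ε', rfl⟩ := exists_eq_invSet hF hD'.1.isSkew hD'.2
  rw [semilin_eq_nrm_of_image hp hFp hn hF h3 hD'.1] at hφ h3
  exact ⟨τ, k, s, m, L 1, h, hφ, h3⟩

/-- Yields n² < q for odd p: there are fewer than √q field automorphisms. -/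
lemma sq_lt_three_pow (n : ℕ) : n ^ 2 < 3 ^ n := by
  induction n with
  | zero => norm_num
  | succ n ih =>
    rcases n with _ | _ | n
    · norm_num
    · norm_num
    · rw [pow_succ 3]
      nlinarith

/-- The elements of a `p`-subgroup of the normalizer of `V E` in the automorphism group with trivial
field automorphism belong to `V E`. -/
lemma mem_affine_groupE_of_refl {p n : ℕ} (hp : p.Prime) (hFp : Nat.card F = p ^ n) (hn : n ≠ 0)
    (hF : Nat.card F % 4 = 3) {D : Set (Fin 3 → F)} (hD : D ∈ invariantSHDS F)
    {r : Equiv.Perm (Fin 3 → F)} {j : ℕ} (hr : r ^ p ^ j = 1) {k s : Fˣ} {m l : F}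
    {h : Fin 3 → F} (hrv : ∀ v, r v = nrm (RingEquiv.refl F) k s m l v + h)
    (hrD : nrm (RingEquiv.refl F) k s m l '' D = D) :
    nrm (RingEquiv.refl F) k s m l ∈ groupE F := by
  obtain ⟨α, β, ε, rfl⟩ := exists_eq_invSet hF hD.1.isSkew hD.2
  refine nrm_mem_groupE hp hFp hn hF hrD hD.1 (j := j) ?_
  obtain ⟨c, hc⟩ := exists_pow_apply hrv (p ^ j)
  rw [hr] at hc
  exact (linear_part_unique (h := c) (k := 0) fun v => by rw [← hc]; simp).1

/-- In a `p`-group of automorphisms normalizing `V E`, the subgroup `V E` has no other conjugates. -/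
lemma conj_affine_groupE_eq {p n : ℕ} (hp : p.Prime) (hFp : Nat.card F = p ^ n) (hn : n ≠ 0)
    (hF : Nat.card F % 4 = 3) {D : Set (Fin 3 → F)} (hD : D ∈ invariantSHDS F)
    {R : Subgroup (Equiv.Perm (Fin 3 → F))} (hPR : affine (groupE F) ≤ R) (hRG : R ≤ designAut D)
    (hRN : R ≤ Subgroup.normalizer (affine (groupE F) : Set (Equiv.Perm (Fin 3 → F))))
    (hR : IsPGroup p R) {g : Equiv.Perm (Fin 3 → F)}
    (hg : (affine (groupE F)).map (MulAut.conj g).toMonoidHom ≤ R) :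
    (affine (groupE F)).map (MulAut.conj g).toMonoidHom = affine (groupE F) := by
  have h2 : (2 : F) ≠ 0 := two_ne_zero_of_odd (odd_card_of_card hF)
  have hq : n ^ 2 < Nat.card F := by
    rw [hFp]
    refine (sq_lt_three_pow n).trans_le (Nat.pow_le_pow_left ?_ n)
    by_contra hlt
    have hp2 : p = 2 := by have := hp.two_le; omega
    rw [hp2] at hFp
    have := Nat.even_pow.2 ⟨even_two, hn⟩
    rw [← hFp] at this
    exact (Nat.not_even_iff_odd.2 (odd_card_of_card hF)) this
  have hcardτ : Nat.card (F ≃+* F) = n := card_ringAut hp hFp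
  choose! τ k s m l h hv hDr using fun r (hr : r ∈ R) =>
    exists_nrm_of_mem_normalizer hp hFp hn hF hD hD (hRN hr) (hRG hr)
  have hrefl : ∀ r ∈ R, τ r = RingEquiv.refl F → nrm (τ r) (k r) (s r) (m r) (l r) ∈ groupE F := by
    intro r hr hτ
    have h1 := hv r hr
    have h3 := hDr r hr
    rw [hτ] at h1 h3 ⊢
    obtain ⟨j, hj⟩ := hR ⟨r, hr⟩
    exact mem_affine_groupE_of_refl hp hFp hn hF hD (Subtype.ext_iff.1 hj) h1 h3
  -- If the field automorphisms agree, a⁻¹b has the trivial one and p-power order, so its linear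
  -- part lies in E. Thus VE has index at most n in R.
  have hquot : ∀ a ∈ R, ∀ b ∈ R, τ a = τ b → a⁻¹ * b ∈ R ∧
      (nrm (τ a) (k a) (s a) (m a) (l a))⁻¹ * nrm (τ b) (k b) (s b) (m b) (l b) ∈ groupE F := by
    intro a ha b hb hab
    have hc : a⁻¹ * b ∈ R := mul_mem (inv_mem ha) hb
    refine ⟨hc, ?_⟩
    set c := a⁻¹ * b with hcdef
    have hmul : nrm (τ a) (k a) (s a) (m a) (l a) * nrm (τ c) (k c) (s c) (m c) (l c) =
        nrm (τ b) (k b) (s b) (m b) (l b) := by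
      refine (linear_part_unique (h := nrm (τ a) (k a) (s a) (m a) (l a) (h c) + h a) (k := h b)
        fun v => ?_).1
      rw [← hv b hb, LinearEquiv.mul_apply, ← add_assoc, ← map_add, ← hv c hc, ← hv a ha,
        ← Equiv.Perm.mul_apply, hcdef, mul_inv_cancel_left]
    have hτc := ringEquiv_of_nrm_mul hmul
    rw [← hmul, inv_mul_cancel_left]
    refine hrefl c hc ?_
    ext x
    have := DFunLike.congr_fun hτc x
    rw [← hab, RingEquiv.trans_apply] at this
    exact ((τ a).injective this).symm
  have hTP : affine (⊥ : Subgroup (AutV F)) ≤ affine (groupE F) := affine_mono bot_le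
  -- the conjugate of the group of translations
  have hconjT : (affine (⊥ : Subgroup (AutV F))).map (MulAut.conj g).toMonoidHom ≤ affine ⊥ := by
    refine le_translations_of_comm (R := R) ((Subgroup.map_mono hTP).trans hg)
      (conj_translations_comm g) (card_conj_translations g) fun r hr hrT => ?_
    refine ⟨_, _, hv r hr, ?_⟩
    have hidx : (affine (⊥ : Subgroup (AutV F))).relIndex R ≤ Nat.card F * n := by
      rw [← Subgroup.relIndex_mul_relIndex _ _ _ hTP hPR]
      refine Nat.mul_le_mul (relIndex_translations_le h2) ?_
      rw [← hcardτ]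
      refine relIndex_le_card_of_fun (fun r : R => τ r) fun a b hab => ?_
      exact inv_mul_mem_affine (hv a a.2) (hv b b.2) (hquot a a.2 b b.2 hab).2
    refine (Nat.mul_le_mul_left _ hidx).trans_lt ?_
    by_cases hτ : τ r = RingEquiv.refl F
    · obtain ⟨x, hx⟩ := (mem_groupE h2).1 (hrefl r hr hτ)
      have hx0 : x ≠ 0 := by
        rintro rfl
        refine hrT (mem_affine_bot.2 ⟨h r, fun v => ?_⟩)
        rw [hv r hr, hx, eAut_zero]
        rfl
      have h3 : n < Nat.card F := lt_of_le_of_lt (Nat.le_self_pow two_ne_zero n) hq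
      have h4 : 0 < Nat.card F * Nat.card F := Nat.mul_pos Nat.card_pos Nat.card_pos
      rw [hx]
      calc _ ≤ Nat.card F * (Nat.card F * n) := Nat.mul_le_mul_right _ (card_fixed_eAut_le hx0)
        _ = Nat.card F * Nat.card F * n := by ring
        _ < Nat.card F * Nat.card F * Nat.card F := Nat.mul_lt_mul_of_pos_left h3 h4
        _ = Nat.card F ^ 3 := by ring
    -- Here |Fix τ|³ ≤ q^(3/2), so the product is at most q^(5/2) n < q³; squaring avoids the
    -- half-integral exponents.
    · have h3 := card_fixed_nrm_le (τ r) (k r) (s r) (m r) (l r)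
      have h4 := sq_card_fixed_le hτ
      set f := Nat.card {v : Fin 3 → F // nrm (τ r) (k r) (s r) (m r) (l r) v = v}
      set e := Nat.card {x : F // τ r x = x}
      set q := Nat.card F
      have hq0 : 0 < q := Nat.card_pos
      refine lt_of_pow_lt_pow_left₀ 2 (Nat.zero_le _) ?_
      calc (f * (q * n)) ^ 2 = f ^ 2 * (q ^ 2 * n ^ 2) := by ring
        _ ≤ (e ^ 3) ^ 2 * (q ^ 2 * n ^ 2) := Nat.mul_le_mul_right _ (Nat.pow_le_pow_left h3 2)
        _ = (e ^ 2) ^ 3 * (q ^ 2 * n ^ 2) := by ring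
        _ ≤ q ^ 3 * (q ^ 2 * n ^ 2) := Nat.mul_le_mul_right _ (Nat.pow_le_pow_left h4 3)
        _ = q ^ 5 * n ^ 2 := by ring
        _ < q ^ 5 * q := Nat.mul_lt_mul_of_pos_left hq (pow_pos hq0 5)
        _ = (q ^ 3) ^ 2 := by ring
  obtain ⟨φ, c, hφ⟩ := exists_affine_of_conj hconjT
  -- the conjugate of the group `E`
  have hlin : ∀ (r : Equiv.Perm (Fin 3 → F)) (χ : AutV F) (d : Fin 3 → F), (∀ v, r v = χ v + d) →
      ∃ d', ∀ v, (g * r * g⁻¹) v = (φ * χ * φ⁻¹) v + d' := by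
    intro r χ d hr
    refine ⟨φ d + c - (φ * χ * φ⁻¹) c, fun v => ?_⟩
    obtain ⟨w, rfl⟩ := g.surjective v
    rw [Equiv.Perm.mul_apply, Equiv.Perm.inv_def, Equiv.symm_apply_apply, Equiv.Perm.mul_apply, hφ,
      hφ, hr, map_add, map_add, ← LinearEquiv.mul_apply (φ * χ * φ⁻¹) φ, inv_mul_cancel_right,
      LinearEquiv.mul_apply φ χ]
    abel
  set E' := (groupE F).map (MulAut.conj φ).toMonoidHom with hE'
  have hE'R : E' ≤ R.comap linPerm := by
    rintro _ ⟨e, he, rfl⟩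
    have h3 : linPerm e ∈ affine (groupE F) := linPerm_mem_affine he
    obtain ⟨d, hd⟩ := hlin (linPerm e) e 0 (fun v => by rw [linPerm_apply, add_zero])
    have h4 : g * linPerm e * g⁻¹ ∈ R := hg ⟨_, h3, rfl⟩
    rw [eq_transPerm_mul_linPerm hd] at h4
    exact (Subgroup.mul_mem_cancel_left _ (hPR (hTP (transPerm_mem d)))).1 h4
  have hlinR : ∀ e : AutV F, linPerm e ∈ R → e = nrm (τ (linPerm e)) (k (linPerm e))
      (s (linPerm e)) (m (linPerm e)) (l (linPerm e)) := fun e he =>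
    (linear_part_unique (h := 0) (k := h (linPerm e)) fun v => by
      rw [← hv _ he, linPerm_apply, add_zero]).1
  -- An element e of E' outside E has τ ≠ 1. As E' is abelian, E' ∩ E centralizes e, so it embeds in
  -- the solutions of sτ(x) = x and has at most √q elements. Its index in E' is at most n, so q ≤ √q
  -- · n, against n² < q.
  have hEE : E' ≤ groupE F := by
    intro e he
    by_contra hne
    have heR : linPerm e ∈ R := hE'R he
    have heq := hlinR e heR
    have hτ : τ (linPerm e) ≠ RingEquiv.refl F := by
      intro hτ
      rw [heq] at hne
      exact hne (hrefl _ heR hτ)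
    have hidx : (groupE F).relIndex (R.comap linPerm) ≤ n := by
      rw [← hcardτ]
      refine relIndex_le_card_of_fun (fun a : R.comap linPerm => τ (linPerm a.1))
        fun a b hab => ?_
      have h3 := (hquot _ a.2 _ b.2 hab).2
      rwa [← hlinR _ a.2, ← hlinR _ b.2] at h3
    have h3 := card_le_card_inf_mul_relIndex (H := groupE F) hE'R
    rw [hE', card_map_conj, card_groupE h2, ← hE'] at h3
    have h4 : Nat.card (groupE F ⊓ E' :) ≤ Nat.card {x : F // τ (linPerm e) x = x} := by
      refine le_trans ?_ (card_affine_fixed_le (τ (linPerm e)) (s (linPerm e)).ne_zero 0)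
      have hcomm : ∀ x, eAut x ∈ E' → (s (linPerm e) : F) * τ (linPerm e) x + 0 = x := by
        rintro x ⟨y, hy, hyx⟩
        obtain ⟨z, hz, hze⟩ := he
        obtain ⟨y, rfl⟩ := (mem_groupE h2).1 hy
        obtain ⟨z, rfl⟩ := (mem_groupE h2).1 hz
        have h5 : e * eAut x = eAut x * e := by
          rw [← hyx, ← hze, ← map_mul, ← map_mul, eAut_mul h2, eAut_mul h2, add_comm]
        rw [heq] at h5
        rw [nrm, semilin_mul_eAut h2, mul_left_inj] at h5
        rw [add_zero]
        exact eAut_injective h5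
      choose y hy using fun a : (groupE F ⊓ E' :) => (mem_groupE h2).1 a.2.1
      refine Nat.card_le_card_of_injective (fun a => ⟨y a, hcomm _ (hy a ▸ a.2.2)⟩) ?_
      intro a b hab
      apply Subtype.ext
      have hab' : y a = y b := Subtype.ext_iff.1 hab
      rw [hy a, hy b, hab']
    have h5 := sq_card_fixed_le hτ
    set f := Nat.card {x : F // τ (linPerm e) x = x}
    set q := Nat.card F
    have h6 : q ≤ f * n := h3.trans (Nat.mul_le_mul h4 hidx)
    have h7 : q ^ 2 ≤ q * n ^ 2 := by
      calc q ^ 2 ≤ (f * n) ^ 2 := Nat.pow_le_pow_left h6 2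
        _ = f ^ 2 * n ^ 2 := by ring
        _ ≤ q * n ^ 2 := Nat.mul_le_mul_right _ h5
    have hq0 : 0 < q := Nat.card_pos
    nlinarith
  refine Subgroup.eq_of_le_of_card_ge ?_ (card_map_conj _ _).ge
  rintro _ ⟨r, hr, rfl⟩
  obtain ⟨χ, hχ, d, hrd⟩ := id hr
  obtain ⟨d', hd'⟩ := hlin r χ d hrd
  exact ⟨_, hEE ⟨χ, hχ, rfl⟩, d', hd'⟩

/-- Isomorphic translation designs of `A`-invariant skew Hadamard difference sets come from
difference sets in the same orbit of the normalizer of `A`. -/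
lemma exists_normalizer_of_designIso {p n : ℕ} (hp : p.Prime) (hFp : Nat.card F = p ^ n)
    (hn : n ≠ 0) (hF : Nat.card F % 4 = 3) {D D' : Set (Fin 3 → F)} (hD : D ∈ invariantSHDS F)
    (hD' : D' ∈ invariantSHDS F)
    (hiso : DesignIso (translationDesign D) (translationDesign D')) :
    ∃ φ ∈ Subgroup.normalizer (groupA F : Set (AutV F)), φ '' D = D' := by
  have h2 : (2 : F) ≠ 0 := two_ne_zero_of_odd (odd_card_of_card hF)
  have := Fact.mk hp
  obtain ⟨g, hg⟩ := hiso
  have hcomp : ∀ a b : Equiv.Perm (Fin 3 → F),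
      (fun B : Set (Fin 3 → F) => (a * b : Equiv.Perm _) '' B) =
        (fun B => a '' B) ∘ (fun B => b '' B) := fun a b => by
    funext B
    exact Set.image_comp a b B
  have hgi : (fun B : Set (Fin 3 → F) => (g⁻¹ : Equiv.Perm _) '' B) '' translationDesign D' =
      translationDesign D := by
    rw [← hg, Set.image_image]
    simp [Set.image_image]
  have hP : IsPGroup p (affine (groupE F)) := by
    refine IsPGroup.of_card (n := n * 4) ?_
    rw [card_affine, card_groupE h2, hFp]
    ring
  obtain ⟨x, hx, hxg⟩ := exists_mul_mem_normalizer (S := designAut D') (g := g)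
    (affine_groupE_le_designAut hD'.2) hP
    (fun R h1 h3 h4 h5 y hy => conj_affine_groupE_eq hp hFp hn hF hD' h1 h3 h4 h5 hy) (by
      rintro _ ⟨r, hr, rfl⟩
      have h3 := mem_designAut.1 (affine_groupE_le_designAut hD.2 hr)
      change g * r * g⁻¹ ∈ designAut D'
      rw [mem_designAut, hcomp, Set.image_comp, hgi, hcomp, Set.image_comp, h3, hg])
  obtain ⟨τ, k, s, m, l, h, -, himg⟩ := exists_nrm_of_mem_normalizer hp hFp hn hF hD hD' hxg (by
    rw [hcomp, Set.image_comp, hg, mem_designAut.1 hx])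
  exact ⟨_, (mem_normalizer_groupA h2).2 ⟨τ, k, s, m, l, rfl⟩, himg⟩

/-- The number of isomorphism classes is at least the number of difference sets divided by the
index of `A` in its normalizer. -/
lemma ncard_invariantSHDS_le {p n : ℕ} (hp : p.Prime) (hFp : Nat.card F = p ^ n)
    (hn : n ≠ 0) (hF : Nat.card F % 4 = 3) :
    (invariantSHDS F).ncard ≤
      (groupA F).relIndex (Subgroup.normalizer (groupA F : Set (AutV F))) *
        numIsoClasses (invariantDesigns F) := by
  classical
  set N := Subgroup.normalizer (groupA F : Set (AutV F)) with hN
  set f : Set (Fin 3 → F) → Quotient (designSetoid (Fin 3 → F)) := fun D =>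
    Quotient.mk _ (translationDesign D) with hf
  have hfin : (invariantSHDS F).Finite := Set.toFinite _
  have h1 : numIsoClasses (invariantDesigns F) = (hfin.toFinset.image f).card := by
    rw [numIsoClasses, invariantDesigns, Set.image_image, ← Set.ncard_coe_finset,
      Finset.coe_image, hfin.coe_toFinset]
  rw [h1, Set.ncard_eq_toFinset_card _ hfin]
  apply Finset.card_le_mul_card_image
  intro c hc
  obtain ⟨D, hD, rfl⟩ := Finset.mem_image.1 hc
  rw [Set.Finite.mem_toFinset] at hD
  have hφ : ∀ D' : {x // x ∈ hfin.toFinset.filter (fun x => f x = f D)},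
      ∃ φ : N, φ.1 '' D = D'.1 := by
    rintro ⟨D', hD'⟩
    rw [Finset.mem_filter, Set.Finite.mem_toFinset] at hD'
    have h3 : DesignIso (translationDesign D) (translationDesign D') :=
      Quotient.exact hD'.2.symm
    obtain ⟨φ, hφ, h4⟩ := exists_normalizer_of_designIso hp hFp hn hF hD hD'.1 h3
    exact ⟨⟨φ, hφ⟩, h4⟩
  choose φ hφ using hφ
  rw [Subgroup.relIndex, Subgroup.index, ← Fintype.card_coe, ← Nat.card_eq_fintype_card]
  -- Since A fixes D, the image of D depends only on the coset, so distinct sets in a fibre give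
  -- distinct cosets.
  refine Nat.card_le_card_of_injective
    (fun D' => (φ D' : N ⧸ (groupA F).subgroupOf N)) fun D₁ D₂ h12 => ?_
  rw [QuotientGroup.eq, Subgroup.mem_subgroupOf] at h12
  have h3 := hD.2 _ h12
  apply Subtype.ext
  rw [← hφ D₁, ← hφ D₂]
  conv_lhs => rw [← h3]
  rw [Set.image_image]
  refine Set.image_congr fun v _ => ?_
  rw [← LinearEquiv.mul_apply]
  simp

end IsomorphismClasses

/-! ### The main theorem -/

/-- Let C be the central binomial coefficient. Of the q + 1 terms adding up to 2^q, the two outer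
ones contribute 2 < C and the other q - 1 at most C each. -/
lemma two_pow_lt_mul_choose {q : ℕ} (hq : Odd q) (hq3 : 3 ≤ q) :
    2 ^ q < q * q.choose ((q + 1) / 2) := by
  obtain ⟨r, rfl⟩ := hq
  have h1 : (2 * r + 1).choose ((2 * r + 1 + 1) / 2) = (2 * r + 1).choose ((2 * r + 1) / 2) := by
    rw [show (2 * r + 1 + 1) / 2 = r + 1 by omega, show (2 * r + 1) / 2 = r by omega]
    exact Nat.choose_symm_half r
  rw [h1]
  set C := (2 * r + 1).choose ((2 * r + 1) / 2) with hC
  have h2 : ∀ i, (2 * r + 1).choose i ≤ C := fun i => Nat.choose_le_middle i _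
  have h3 : 2 < C := by
    have := h2 1
    rw [Nat.choose_one_right] at this
    omega
  have h4 := Nat.sum_range_choose (2 * r + 1)
  rw [Finset.sum_range_succ, Finset.sum_range_succ', Nat.choose_self, Nat.choose_zero_right] at h4
  have h5 : ∑ i ∈ Finset.range (2 * r), (2 * r + 1).choose (i + 1) ≤ 2 * r * C := by
    have := Finset.sum_le_card_nsmul (Finset.range (2 * r))
      (fun i => (2 * r + 1).choose (i + 1)) C (fun i _ => h2 _)
    simpa using this
  rw [← h4, add_mul, one_mul]
  omega

lemma injOn_translationDesign {F : Type*} [Field F] [Finite F] (hF : Nat.card F % 4 = 3) :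
    Set.InjOn translationDesign (invariantSHDS F) := by
  intro D hD D' hD' h
  refine (hD'.1.eq_of_mem_translationDesign (three_lt_card_space hF) (card_space_odd hF) hD.1 ?_)
  rw [← h]
  exact mem_translationDesign_self D

theorem mainTheorem3 (p n q : ℕ) (hp : p.Prime) (hp4 : p % 4 = 3) (hn : Odd n) (hq : q = p ^ n)
    (F : Type*) [Field F] [Finite F] (hF : Nat.card F = q) :
    -- the order of the normalizer of `A` in `Aut(V)`, and the index of `A` in it
    Nat.card (Subgroup.normalizer (groupA F : Set (AutV F))) = n * (q - 1) ^ 2 * q ^ 2 ∧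
    (groupA F).relIndex (Subgroup.normalizer (groupA F : Set (AutV F))) =
      2 * n * (q - 1) * q ∧
    -- the constructed designs are symmetric designs, and their number
    (∀ 𝓑 ∈ invariantDesigns F,
      IsSymmetricDesign 𝓑 (q ^ 3) ((q ^ 3 - 1) / 2) ((q ^ 3 - 3) / 4)) ∧
    (invariantSHDS F).ncard = 4 * q.choose ((q + 1) / 2) ∧
    (invariantDesigns F).ncard = 4 * q.choose ((q + 1) / 2) ∧
    -- the number of isomorphism classes of these designs
    (4 * q.choose ((q + 1) / 2) : ℝ) / (2 * n * (q - 1) * q) ≤ numIsoClasses (invariantDesigns F) ∧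
    (4 * q.choose ((q + 1) / 2) : ℝ) / (2 * n * (q - 1) * q) >
      ((2 : ℝ) ^ (q + 2) / q) / (2 * n * q * (q - 1)) ∧
    ((2 : ℝ) ^ (q + 2) / q) / (2 * n * q * (q - 1)) > (2 : ℝ) ^ (q + 1) / (q : ℝ) ^ 4 := by
  classical
  have := Fintype.ofFinite F
  have hn0 : n ≠ 0 := by rintro rfl; exact absurd hn (by decide)
  have hFp : Nat.card F = p ^ n := hF.trans hq
  -- p² ≡ 1 mod 4 and n is odd.
  have hq4 : q % 4 = 3 := by
    obtain ⟨r, rfl⟩ := hn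
    rw [hq, pow_succ, pow_mul, Nat.mul_mod, Nat.pow_mod, Nat.pow_mod p 2, hp4]
    norm_num
  have hF4 : Nat.card F % 4 = 3 := by rw [hF, hq4]
  have h2 : (2 : F) ≠ 0 := two_ne_zero_of_odd (odd_card_of_card hF4)
  have hcard := card_normalizer_groupA h2
  have hidx := relIndex_groupA h2
  have hcount := ncard_invariantSHDS hF4
  have hiso := ncard_invariantSHDS_le hp hFp hn0 hF4
  have hinj := injOn_translationDesign hF4
  rw [card_ringAut hp hFp, hF] at hcard hidx
  rw [hidx, hcount] at hiso
  rw [hF] at hcount hiso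
  have hq3 : 3 ≤ q := by omega
  have hnq : n < q := by rw [hq]; exact Nat.lt_pow_self hp.one_lt
  have hqR : (3 : ℝ) ≤ q := by exact_mod_cast hq3
  have hnR : (0 : ℝ) < n := by exact_mod_cast Nat.pos_of_ne_zero hn0
  have hnqR : (n : ℝ) < q := by exact_mod_cast hnq
  have hq1R : (0 : ℝ) < (q : ℝ) - 1 := by linarith
  have hq0R : (0 : ℝ) < q := by linarith
  refine ⟨hcard, hidx, ?_, hcount, ?_, ?_, ?_, ?_⟩
  · rintro _ ⟨D, hD, rfl⟩
    have h3 := hD.1.isSymmetricDesign (three_lt_card_space hF4) (card_space_odd hF4)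
    rwa [card_fin_three, hF] at h3
  · rw [invariantDesigns, hinj.ncard_image, hcount]
  · rw [div_le_iff₀ (by positivity)]
    have h3 : ((4 * q.choose ((q + 1) / 2) : ℕ) : ℝ) ≤
        ((2 * n * (q - 1) * q * numIsoClasses (invariantDesigns F) : ℕ) : ℝ) := by
      exact_mod_cast hiso
    push_cast [Nat.cast_sub (show 1 ≤ q by omega)] at h3
    linarith
  · have h3 : ((2 ^ q : ℕ) : ℝ) < ((q * q.choose ((q + 1) / 2) : ℕ) : ℝ) := by
      exact_mod_cast two_pow_lt_mul_choose (Nat.odd_iff.2 (by omega)) hq3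
    push_cast at h3
    rw [gt_iff_lt, show (2 : ℝ) * n * q * (q - 1) = 2 * n * (q - 1) * q by ring]
    apply div_lt_div_of_pos_right _ (by positivity)
    rw [div_lt_iff₀ hq0R, pow_add]
    linarith
  · have h3 : (2 : ℝ) ^ (q + 2) / q / (2 * n * q * (q - 1)) =
        2 ^ (q + 1) / (n * q ^ 2 * (q - 1)) := by
      field_simp
      ring
    rw [gt_iff_lt, h3]
    apply div_lt_div_of_pos_left (by positivity) (by positivity)
    -- Follows from n < q; multiplied by q² it compares the two denominators.
    have h4 : (n : ℝ) * (q - 1) < q * q := by nlinarith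
    have h5 : (0 : ℝ) < (q : ℝ) ^ 2 := by positivity
    nlinarith
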